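/- All graphs are finite, simple and undirected. For a graph $G=(V,E)$ and $R\subseteq V$ let $G[R]$ be the subgraph induced by $R$ and let $\partial R=\{u\in V\setminus R : uv\in E \text{ for some } v\in R\}$. A set $S$ is an $(X,Y)$-separator in a graph $H$ if $X,Y,S$ (some of which may be empty) partition the vertex set of $H$ and no vertex of $X$ is connected by a path to a vertex of $Y$ in $H$ after the vertices of $S$ are removed. A separator decomposition of $G$ is a finite full binary rooted tree, each node $i$ of which carries a pair $(V_i,S_i)$ of subsets of $V$, such that $V_r=V$ for the root $r$, $V_\ell=S_\ell=\emptyset$ for every leaf $\ell$, and, for every non-leaf node $i$ with children $j,k$, $S_i$ is a $(V_j,V_k)$-separator in $G[V_i]$. Its width is the maximum of all $|\partial V_i|$ and $|S_i|$ over all nodes $i$. Let $\mathrm{sw}(G)$ be the minimum width of a separator decomposition of $G$, and let $\mathrm{tw}(G)$ be the treewidth of $G$ (the minimum over all tree decompositions of the largest bag size minus one; so it is $-1$ for the graph without vertices). **Theorem.** For every graph $G$, $$\frac{1}{8}\,\mathrm{tw}(G)+\frac{1}{24}\;\le\;\mathrm{sw}(G)\;\le\;3\,\mathrm{tw}(G)+3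 .$$ Moreover, there is a deterministic algorithm that, given a graph $G$ with $n$ vertices (as its adjacency matrix), constructs a separator decomposition of $G$ of width at most $3(k+1)$, where $k=\mathrm{tw}(G)$, in time $2^{O(k)}\cdot\mathrm{poly}(n)$: there are a constant $c$ and a polynomial $p$ such that the running time is at most $2^{c\cdot\max(k,0)}\cdot p(n)$ for all such graphs. (Time is measured in a fixed programming language on binary trees whose running times are polynomially related to those of deterministic Turing machines.) -/

import Mathlib

namespace SepWidth

/-! ### Separator decompositions -/

open Classical in
/-- The vertex boundary `∂R` of `R` in `G`: the vertices outside `R` with a neighbour in `R`. -/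
noncomputable def vertexBoundary {V : Type*} [Fintype V] (G : SimpleGraph V) (R : Finset V) :
    Finset V :=
  Finset.univ.filter fun u => u ∉ R ∧ ∃ v ∈ R, G.Adj u v

/-- `S` is an `(X, Y)`-separator in the induced subgraph `G[R]`: the (possibly empty) sets
`X`, `Y`, `S` partition `R`, and no vertex of `X` is connected to a vertex of `Y` in `G[R \ S]`. -/
structure IsSeparatorIn {V : Type*} (G : SimpleGraph V) (R X Y S : Finset V) : Prop where
  cover : ∀ v, v ∈ R ↔ v ∈ X ∨ v ∈ Y ∨ v ∈ S
  disjoint_left_right : Disjoint X Y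
  disjoint_left_sep : Disjoint X S
  disjoint_right_sep : Disjoint Y S
  separated : ∀ u v : ((R : Set V) \ (S : Set V) : Set V), u.1 ∈ X → v.1 ∈ Y →
    ¬ (G.induce ((R : Set V) \ (S : Set V))).Reachable u v

/-- Finite rooted full binary trees whose nodes carry pairs `(V_i, S_i)` of vertex sets.
Leaves carry no data, since in a separator decomposition their pair is always `(∅, ∅)`. -/
inductive SepTree (V : Type*) where
  | leaf : SepTree V
  | node (U S : Finset V) (l r : SepTree V) : SepTree V

namespace SepTree

/-- The vertex set `V_i` at the root of a labelled tree. -/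
def vertexSet {V : Type*} : SepTree V → Finset V
  | leaf => ∅
  | node U _ _ _ => U

/-- At every inner node `i` with children `j`, `k`, the set `S_i` is a
`(V_j, V_k)`-separator in `G[V_i]`. -/
def Separates {V : Type*} (G : SimpleGraph V) : SepTree V → Prop
  | leaf => True
  | node U S l r =>
      IsSeparatorIn G U l.vertexSet r.vertexSet S ∧ l.Separates G ∧ r.Separates G

/-- `t` is a separator decomposition of `G`. -/
def IsDecomposition {V : Type*} [Fintype V] (G : SimpleGraph V) (t : SepTree V) : Prop :=
  t.vertexSet = Finset.univ ∧ t.Separates G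

/-- The maximum of `|∂V_i|` and `|S_i|` over all nodes `i`; a leaf has `V_i = S_i = ∅`, so that
it contributes `0`. -/
noncomputable def width {V : Type*} [Fintype V] (G : SimpleGraph V) : SepTree V → ℕ
  | leaf => 0
  | node U S l r =>
      max (max (vertexBoundary G U).card S.card) (max (l.width G) (r.width G))

end SepTree

/-- The minimum width of a separator decomposition of `G`. -/
noncomputable def separatorWidth {V : Type*} [Fintype V] (G : SimpleGraph V) : ℕ :=
  sInf {w | ∃ t : SepTree V, t.IsDecomposition G ∧ t.width G = w}

/-! ### Treewidth -/

/-- A tree decomposition of `G`, indexed by the nodes of a finite tree. -/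
structure TreeDecomposition {V : Type*} (G : SimpleGraph V) where
  size : ℕ
  tree : SimpleGraph (Fin size)
  isTree : tree.IsTree
  bag : Fin size → Finset V
  vertex_mem : ∀ v, ∃ i, v ∈ bag i
  edge_mem : ∀ u v, G.Adj u v → ∃ i, u ∈ bag i ∧ v ∈ bag i
  connected : ∀ v, (tree.induce {i | v ∈ bag i}).Connected

/-- The size of the largest bag minus one (an integer, `-1` if all bags are empty). -/
def TreeDecomposition.width {V : Type*} {G : SimpleGraph V} (D : TreeDecomposition G) : ℤ :=
  ((Finset.univ.sup fun i => (D.bag i).card : ℕ) : ℤ) - 1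

/-- The minimum width of a tree decomposition of `G`; it is `-1` for the graph without vertices
and nonnegative for every other graph. -/
noncomputable def treewidth {V : Type*} (G : SimpleGraph V) : ℤ :=
  ⨅ D : TreeDecomposition G, D.width

/-! ### A programming language with a time measure

The data are binary trees, as in list-processing languages. Programs are built from the
primitives of such a language by composition, case distinction and while-loops. Each
application of a program construct to a tree is charged the full size of that tree (at least
one), so that values are paid for as if they were copied. Hence time in this model and time on a
deterministic multitape Turing machine are polynomially related. -/

/-- Binary trees. -/
inductive Data where
  | nil : Data
  | cons (a b : Data) : Data

namespace Data

/-- The number of nodes of a tree. -/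
def size : Data → ℕ
  | nil => 1
  | cons a b => a.size + b.size + 1

/-- The left subtree. -/
def hd : Data → Data
  | nil => nil
  | cons a _ => a

/-- The right subtree. -/
def tl : Data → Data
  | nil => nil
  | cons _ b => b

/-- Truth values as trees; `nil` is false. -/
def ofBool : Bool → Data
  | false => nil
  | true => cons nil nil

/-- Lists of trees as trees. -/
def ofList : List Data → Data
  | [] => nil
  | a :: l => cons a (ofList l)

/-- A subset of `{0, …, n - 1}`, written as its list of `n` membership bits. -/
def ofFinset {n : ℕ} (s : Finset (Fin n)) : Data :=
  ofList (List.ofFn fun i => ofBool (decide (i ∈ s)))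

open Classical in
/-- A graph on `{0, …, n - 1}`, written as its adjacency matrix, row by row. -/
noncomputable def ofGraph {n : ℕ} (G : SimpleGraph (Fin n)) : Data :=
  ofList (List.ofFn fun i => ofList (List.ofFn fun j => ofBool (decide (G.Adj i j))))

/-- A binary tree labelled with pairs of vertex sets, written out in full. -/
def ofSepTree {n : ℕ} : SepTree (Fin n) → Data
  | .leaf => nil
  | .node U S l r => cons (cons (ofFinset U) (ofFinset S)) (cons (ofSepTree l) (ofSepTree r))

end Data

/-- Programs, each of which maps an input tree to an output tree if it terminates:
identity, constant `nil`, left and right subtree, pairing, composition (`comp f g` is `f` after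
`g`), case distinction, and the loop "while `c` is not `nil`, apply `f`". -/
inductive Program where
  | id : Program
  | nil : Program
  | hd : Program
  | tl : Program
  | cons (f g : Program) : Program
  | comp (f g : Program) : Program
  | cond (c f g : Program) : Program
  | loop (c f : Program) : Program

/-- `Runs P x y t`: on input `x` the program `P` terminates with output `y` in time exactly `t`. -/
inductive Program.Runs : Program → Data → Data → ℕ → Prop where
  | id (x : Data) : Runs .id x x x.size
  | nil (x : Data) : Runs .nil x .nil x.size
  | hd (x : Data) : Runs .hd x x.hd x.size
  | tl (x : Data) : Runs .tl x x.tl x.size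
  | cons {f g : Program} {x y z : Data} {s t : ℕ} :
      Runs f x y s → Runs g x z t → Runs (.cons f g) x (.cons y z) (s + t + x.size)
  | comp {f g : Program} {x y z : Data} {s t : ℕ} :
      Runs g x y s → Runs f y z t → Runs (.comp f g) x z (s + t + x.size)
  | cond_true {c f g : Program} {x b y : Data} {s t : ℕ} :
      Runs c x b s → b ≠ .nil → Runs f x y t → Runs (.cond c f g) x y (s + t + x.size)
  | cond_false {c f g : Program} {x y : Data} {s t : ℕ} :
      Runs c x .nil s → Runs g x y t → Runs (.cond c f g) x y (s + t + x.size)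
  | loop_stop {c f : Program} {x : Data} {s : ℕ} :
      Runs c x .nil s → Runs (.loop c f) x x (s + x.size)
  | loop_step {c f : Program} {x b y z : Data} {s t r : ℕ} :
      Runs c x b s → b ≠ .nil → Runs f x y t → Runs (.loop c f) y z r →
        Runs (.loop c f) x z (s + t + r + x.size)

/-- Programs are deterministic: output and running time are determined by the input. -/
theorem Program.Runs.unique {P : Program} {x y y' : Data} {t t' : ℕ}
    (h : P.Runs x y t) (h' : P.Runs x y' t') : y = y' ∧ t = t' := by
  induction h generalizing y' t' with
  | id | nil | hd | tl => cases h'; exact ⟨rfl, rfl⟩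
  | cons _ _ ih₁ ih₂ =>
    cases h' with
    | cons a b =>
      obtain ⟨rfl, rfl⟩ := ih₁ a
      obtain ⟨rfl, rfl⟩ := ih₂ b
      exact ⟨rfl, rfl⟩
  | comp _ _ ih₁ ih₂ =>
    cases h' with
    | comp a b =>
      obtain ⟨rfl, rfl⟩ := ih₁ a
      obtain ⟨rfl, rfl⟩ := ih₂ b
      exact ⟨rfl, rfl⟩
  | cond_true _ hb _ ih₁ ih₂ =>
    cases h' with
    | cond_true a _ b =>
      obtain ⟨rfl, rfl⟩ := ih₁ a
      obtain ⟨rfl, rfl⟩ := ih₂ b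
      exact ⟨rfl, rfl⟩
    | cond_false a _ => exact absurd (ih₁ a).1 hb
  | cond_false _ _ ih₁ ih₂ =>
    cases h' with
    | cond_true a hb _ => exact absurd (ih₁ a).1.symm hb
    | cond_false a b =>
      obtain ⟨-, rfl⟩ := ih₁ a
      obtain ⟨rfl, rfl⟩ := ih₂ b
      exact ⟨rfl, rfl⟩
  | loop_stop _ ih₁ =>
    cases h' with
    | loop_stop a =>
      obtain ⟨-, rfl⟩ := ih₁ a
      exact ⟨rfl, rfl⟩
    | loop_step a hb _ _ => exact absurd (ih₁ a).1.symm hb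
  | loop_step _ hb _ _ ih₁ ih₂ ih₃ =>
    cases h' with
    | loop_stop a => exact absurd (ih₁ a).1 hb
    | loop_step a _ b c =>
      obtain ⟨rfl, rfl⟩ := ih₁ a
      obtain ⟨rfl, rfl⟩ := ih₂ b
      obtain ⟨rfl, rfl⟩ := ih₃ c
      exact ⟨rfl, rfl⟩

/-- Every output is paid for. -/
theorem Program.Runs.size_le {P : Program} {x y : Data} {t : ℕ} (h : P.Runs x y t) :
    y.size ≤ t := by
  have pos : ∀ d : Data, 1 ≤ d.size := fun d => by cases d <;> simp [Data.size]
  induction h with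
  | id x => exact le_rfl
  | nil x => exact pos x
  | hd x => cases x <;> simp [Data.hd, Data.size]; omega
  | tl x => cases x <;> simp [Data.tl, Data.size]; omega
  | @cons f g x y z s t h1 h2 ih₁ ih₂ =>
    have := pos x
    simp only [Data.size]; omega
  | _ => omega

end SepWidth

/-! Both inequalities follow from the sharper comparison `tw + 1 ≤ 2 * sw` and `sw ≤ tw + 1`.

Lower bound: in a separator decomposition of width `w` the sets `S_i ∪ ∂V_i` have at most `2w`
elements, and they are the bags of a tree decomposition. The boundary of a child lies in the set
`S_i ∪ ∂V_i` of its parent, so the bags can be attached one after another as leaves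
(`IsPartialDecomposition.addLeaf`, `IsPartialDecomposition.extend`).

Upper bound: walk through a tree decomposition while keeping `∂U` inside the current bag. Remove the
part of `U` in the bag, or split `U` along the components of the tree without the current node, or
move to a neighbouring node (`TreeDecomposition.exists_sepTree`). Every `S_i ∪ ∂V_i` then lies in
one bag. This property, `SepTree.BagsLe`, is stronger than a width bound, and it also yields
balanced separators: descend to a child as long as it holds more than half of a given set `W`, and
cut with `S_i ∪ ∂V_i` where this stops (`SepTree.exists_balanced`).

The algorithm decomposes a set `U` with `|∂U| ≤ 3b`. If `|∂U| < 3b`, it splits off one vertex.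
Otherwise it runs through all words over three letters on `W = ∂U`; a word names two parts `A` and
`B` of `W`, and a minimum vertex cut `S` in `U` between their neighbourhoods is computed by
augmenting paths. If `|S|` is at most `|A|` and `|B|`, both sides again have boundary at most `3b`,
since `S` replaces `B` or `A` (`isGoodSplit_of_mem`). If `tw < b`, a balanced separator shows that
some word succeeds (`exists_trySplit`). So when all words fail, `b` may be raised by one without
ever exceeding `tw + 1`.

Running time: one step of the algorithm is a polynomial-time function of its state (`PT.step`). The
list of the `3^(3b)` words is part of the state, so the exponential factor enters only through the
size of the state. The number of steps is linear in `n` and `tw` (`stepBound`, `inv_step`). A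
polynomial evaluated at `a * 2^(7K)` with `K = tw + 1` is `2^O(tw)` times a polynomial in `a`
(`eval_mul_le`). -/

namespace SepWidth

/-! ### Functions computable in polynomial time -/

/-- Encodings of the elements of a type as binary trees. -/
class Enc (α : Type) where
  enc : α → Data

open Enc

/-- The number of nodes of the code of `a`. -/
def sz {α : Type} [Enc α] (a : α) : ℕ := (enc a).size

instance : Enc Data := ⟨id⟩
instance : Enc Bool := ⟨Data.ofBool⟩
instance {α : Type} [Enc α] : Enc (List α) := ⟨fun l => Data.ofList (l.map enc)⟩
instance : Enc ℕ := ⟨fun n => Data.ofList (List.replicate n Data.nil)⟩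
instance {α β : Type} [Enc α] [Enc β] : Enc (α × β) := ⟨fun p => .cons (enc p.1) (enc p.2)⟩

/-! ### Sizes of codes. -/

section Size
variable {α β : Type} [Enc α] [Enc β]

theorem Data.one_le_size (d : Data) : 1 ≤ d.size := by cases d <;> simp [Data.size]

theorem one_le_sz (a : α) : 1 ≤ sz a := Data.one_le_size _

theorem sz_pair (a : α) (b : β) : sz (a, b) = sz a + sz b + 1 := rfl

theorem sz_nil : sz ([] : List α) = 1 := rfl

theorem sz_cons (a : α) (l : List α) : sz (a :: l) = sz a + sz l + 1 := rfl

theorem sz_nat (n : ℕ) : sz n = 2 * n + 1 := by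
  induction n with
  | zero => rfl
  | succ n ih =>
    have : sz (n + 1) = 1 + sz n + 1 := rfl
    omega

theorem sz_bool (b : Bool) : sz b ≤ 3 := by cases b <;> decide

theorem sz_append (l m : List α) : sz (l ++ m) + 1 = sz l + sz m := by
  induction l with
  | nil => simp [sz_nil, add_comm]
  | cons a l ih => simp only [List.cons_append, sz_cons]; omega

theorem sz_le_of_mem {a : α} {l : List α} (h : a ∈ l) : sz a < sz l := by
  induction l with
  | nil => simp at h
  | cons b l ih =>
    rw [sz_cons]
    rcases List.mem_cons.1 h with rfl | h
    · omega
    · have := ih h; omega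

theorem length_le_sz (l : List α) : l.length < sz l := by
  induction l with
  | nil => simp [sz_nil]
  | cons b l ih => rw [sz_cons, List.length_cons]; have := one_le_sz b; omega

theorem sz_le_of_forall {l : List α} {K : ℕ} (h : ∀ a ∈ l, sz a ≤ K) :
    sz l ≤ l.length * (K + 1) + 1 := by
  induction l with
  | nil => simp [sz_nil]
  | cons b l ih =>
    rw [sz_cons, List.length_cons, Nat.succ_mul]
    have := h b (by simp)
    have := ih fun a ha => h a (by simp [ha])
    omega

theorem sz_filter_le (p : α → Bool) (l : List α) : sz (l.filter p) ≤ sz l := by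
  induction l with
  | nil => simp
  | cons b l ih => rw [List.filter_cons]; split <;> simp only [sz_cons] <;> omega

end Size

theorem Polynomial.eval_mono_nat (p : Polynomial ℕ) {a b : ℕ} (h : a ≤ b) :
    p.eval a ≤ p.eval b := by
  induction p using Polynomial.induction_on' with
  | add p q hp hq => simpa using add_le_add hp hq
  | monomial n c => simpa using Nat.mul_le_mul_left c (Nat.pow_le_pow_left h n)

/-- `f` is computed by a program whose running time is polynomial in the size of the input. -/
def PT {α β : Type} [Enc α] [Enc β] (f : α → β) : Prop :=
  ∃ (P : Program) (p : Polynomial ℕ), ∀ a, ∃ t ≤ p.eval (sz a), P.Runs (enc a) (enc (f a)) t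

/-! ### Closure properties of polynomial-time functions. -/

namespace PT
variable {Γ α β δ : Type} [Enc Γ] [Enc α] [Enc β] [Enc δ]

theorem size_bound {f : α → β} (hf : PT f) :
    ∃ p : Polynomial ℕ, ∀ a, sz (f a) ≤ p.eval (sz a) := by
  obtain ⟨P, p, h⟩ := hf
  refine ⟨p, fun a => ?_⟩
  obtain ⟨t, ht, hr⟩ := h a
  exact hr.size_le.trans ht

/-- Changing the codes of the values to equal ones. -/
theorem congr_enc {f : α → β} {g : α → δ} (hf : PT f) (h : ∀ a, enc (f a) = enc (g a)) : PT g := by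
  obtain ⟨P, p, hP⟩ := hf
  exact ⟨P, p, fun a => h a ▸ hP a⟩

theorem of_eq {f g : α → β} (hf : PT f) (h : ∀ a, f a = g a) : PT g :=
  (funext h : f = g) ▸ hf

theorem id : PT (fun a : α => a) :=
  ⟨.id, .X, fun a => ⟨_, by simp [sz], .id _⟩⟩

theorem comp {g : β → δ} {f : α → β} (hg : PT g) (hf : PT f) : PT (fun a => g (f a)) := by
  obtain ⟨P, p, hP⟩ := hf
  obtain ⟨Q, q, hQ⟩ := hg
  refine ⟨.comp Q P, p + q.comp p + .X, fun a => ?_⟩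
  obtain ⟨t, ht, hr⟩ := hP a
  obtain ⟨u, hu, hs⟩ := hQ (f a)
  refine ⟨_, ?_, .comp hr hs⟩
  have := Polynomial.eval_mono_nat q (hr.size_le.trans ht)
  simp only [Polynomial.eval_add, Polynomial.eval_comp, Polynomial.eval_X]
  exact add_le_add (add_le_add ht (hu.trans this)) le_rfl

theorem pair {f : Γ → α} {g : Γ → β} (hf : PT f) (hg : PT g) : PT (fun a => (f a, g a)) := by
  obtain ⟨P, p, hP⟩ := hf
  obtain ⟨Q, q, hQ⟩ := hg
  refine ⟨.cons P Q, p + q + .X, fun a => ?_⟩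
  obtain ⟨t, ht, hr⟩ := hP a
  obtain ⟨u, hu, hs⟩ := hQ a
  refine ⟨_, ?_, .cons hr hs⟩
  simp only [Polynomial.eval_add, Polynomial.eval_X]
  exact add_le_add (add_le_add ht hu) le_rfl

/-- The code of a pair of trees, read as one tree. -/
theorem data_cons {f g : Γ → Data} (hf : PT f) (hg : PT g) :
    PT (fun a => Data.cons (f a) (g a)) :=
  (pair hf hg).congr_enc fun _ => rfl

theorem cons {f : Γ → α} {g : Γ → List α} (hf : PT f) (hg : PT g) : PT (fun a => f a :: g a) :=
  (pair hf hg).congr_enc fun _ => rfl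

theorem toData {f : Γ → α} (hf : PT f) : PT (fun a => enc (f a)) := hf.congr_enc fun _ => rfl

theorem fst {f : Γ → α × β} (hf : PT f) : PT (fun a => (f a).1) :=
  comp (g := Prod.fst) ⟨.hd, .X, fun _ => ⟨_, by simp [sz], .hd _⟩⟩ hf

theorem snd {f : Γ → α × β} (hf : PT f) : PT (fun a => (f a).2) :=
  comp (g := Prod.snd) ⟨.tl, .X, fun _ => ⟨_, by simp [sz], .tl _⟩⟩ hf

theorem tail {f : Γ → List α} (hf : PT f) : PT (fun a => (f a).tail) :=
  comp (g := List.tail) ⟨.tl, .X, fun l => ⟨sz l, by simp, by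
    cases l
    · exact .tl _
    · exact .tl _⟩⟩ hf

theorem const_data (d : Data) : PT (fun _ : Γ => d) := by
  induction d with
  | nil => exact ⟨.nil, .X, fun _ => ⟨_, by simp [sz], .nil _⟩⟩
  | cons a b ha hb => exact data_cons ha hb

theorem const (b : β) : PT (fun _ : Γ => b) := (const_data (enc b)).congr_enc fun _ => rfl

/-- The language branches on whether a tree is `nil`, so any value can serve as a test. This covers
Boolean tests and tests for the empty list alike. -/
theorem ite_enc {p : Γ → Prop} [DecidablePred p] {c : Γ → δ} {f g : Γ → α} (hc : PT c)
    (hp : ∀ a, p a ↔ enc (c a) ≠ .nil) (hf : PT f) (hg : PT g) :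
    PT (fun a => if p a then f a else g a) := by
  obtain ⟨R, r, hR⟩ := hc
  obtain ⟨P, p', hP⟩ := hf
  obtain ⟨Q, q, hQ⟩ := hg
  refine ⟨.cond R P Q, r + p' + q + .X, fun a => ?_⟩
  obtain ⟨v, hv, hw⟩ := hR a
  obtain ⟨t, ht, hr⟩ := hP a
  obtain ⟨u, hu, hs⟩ := hQ a
  simp only [Polynomial.eval_add, Polynomial.eval_X]
  by_cases h : p a
  · simp only [h, if_true]
    exact ⟨_, by simp only [sz] at *; omega, .cond_true hw ((hp a).1 h) hr⟩
  · simp only [h, if_false]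
    rw [hp a, not_not] at h
    rw [h] at hw
    exact ⟨_, by simp only [sz] at *; omega, .cond_false hw hs⟩

theorem ite {p : Γ → Prop} [DecidablePred p] {f g : Γ → α} (hp : PT (fun a => decide (p a)))
    (hf : PT f) (hg : PT g) : PT (fun a => if p a then f a else g a) :=
  ite_enc hp (fun a => by by_cases h : p a <;> simp [h, enc, Data.ofBool]) hf hg

theorem data_hd {f : Γ → Data} (hf : PT f) : PT (fun a => (f a).hd) :=
  comp (g := Data.hd) ⟨.hd, .X, fun x => ⟨sz x, by simp, .hd _⟩⟩ hf

theorem headD {l : Γ → List α} {d : Γ → α} (hl : PT l) (hd : PT d) :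
    PT (fun a => (l a).headD (d a)) := by
  have h := ite_enc (p := fun a => l a ≠ []) hl (fun a => by cases l a <;> simp [enc, Data.ofList])
    (data_hd (toData hl)) (toData hd)
  refine h.congr_enc fun a => ?_
  cases l a <;> rfl

theorem eq_bool_true {b : Γ → Bool} (hb : PT b) : PT (fun a => decide (b a = true)) :=
  hb.of_eq fun a => by simp

theorem not {p : Γ → Prop} [DecidablePred p] (hp : PT (fun a => decide (p a))) :
    PT (fun a => decide (¬ p a)) :=
  (ite hp (const false) (const true)).of_eq fun a => by by_cases h : p a <;> simp [h]

theorem and {p q : Γ → Prop} [DecidablePred p] [DecidablePred q] (hp : PT (fun a => decide (p a)))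
    (hq : PT (fun a => decide (q a))) : PT (fun a => decide (p a ∧ q a)) :=
  (ite hp hq (const false)).of_eq fun a => by by_cases h : p a <;> simp [h]

theorem eq_nil {l : Γ → List α} (hl : PT l) : PT (fun a => decide (l a = [])) :=
  (ite_enc (p := fun a => l a ≠ []) hl (fun a => by cases l a <;> simp [enc, Data.ofList])
    (const false) (const true)).of_eq fun a => by by_cases h : l a = [] <;> simp [h]

/-- Folding is a polynomial-time operation as long as the intermediate results stay small. -/
theorem foldl {l : Γ → List α} {i : Γ → β} {s : Γ → β → α → β} (hl : PT l) (hi : PT i)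
    (hs : PT (fun p : (Γ × β) × α => s p.1.1 p.1.2 p.2))
    (hb : ∃ q : Polynomial ℕ, ∀ a l', l' <+: l a → sz (l'.foldl (s a) (i a)) ≤ q.eval (sz a)) :
    PT (fun a => (l a).foldl (s a) (i a)) := by
  obtain ⟨q, hq⟩ := hb
  obtain ⟨pl, hpl⟩ := hl.size_bound
  have hbody : PT (fun p : (Γ × β) × (α × List α) =>
      ((p.1.1, s p.1.1 p.1.2 p.2.1), p.2.2)) :=
    pair (pair (fst (fst id)) (comp hs (pair (fst id) (fst (snd id))))) (snd (snd id))
  obtain ⟨body, r, hr⟩ := hbody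
  obtain ⟨I, u, hu⟩ := pair (pair id hi) hl
  -- A bound for all loop states: the context, an accumulator over a prefix of the list, the rest of
  -- the list, and the two pair nodes. A round pays at most `2 * M` for the test and the loop
  -- itself, and then for the body.
  let M : Polynomial ℕ := .X + q + pl + 2
  have key : ∀ a k l', l a = l' ++ k → ∃ t ≤ (k.length + 1) * (2 * M.eval (sz a) + r.eval (M.eval (sz a))),
      (Program.loop .tl body).Runs (enc ((a, l'.foldl (s a) (i a)), k))
        (enc ((a, (l a).foldl (s a) (i a)), ([] : List α))) t := by
    intro a k
    have hM : ∀ k l', l a = l' ++ k → sz ((a, l'.foldl (s a) (i a)), k) ≤ M.eval (sz a) := by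
      intro k l' h
      have h1 := hq a l' ⟨k, h.symm⟩
      have h2 := hpl a
      have h3 := sz_append l' k
      rw [← h] at h3
      have := one_le_sz l'
      simp only [sz_pair, M, Polynomial.eval_add, Polynomial.eval_X, Polynomial.eval_ofNat]
      omega
    induction k with
    | nil =>
      intro l' h
      have hM := hM _ _ h
      rw [List.append_nil] at h
      subst h
      refine ⟨_, ?_, Program.Runs.loop_stop (.tl _)⟩
      simp only [sz, List.length_nil] at hM ⊢
      omega
    | cons x k ih =>
      intro l' h
      have hM := hM _ _ h
      obtain ⟨t, ht, ht'⟩ := ih (l' ++ [x]) (by simpa using h)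
      obtain ⟨v, hv, hv'⟩ := hr ((a, l'.foldl (s a) (i a)), (x, k))
      rw [List.foldl_append] at ht'
      refine ⟨_, ?_, .loop_step (.tl _) (by simp [enc, Data.ofList, Data.tl]) hv' ht'⟩
      have h3 := hv.trans (Polynomial.eval_mono_nat r hM)
      rw [List.length_cons, Nat.succ_mul (k.length + 1)]
      simp only [sz] at hM ht h3 ⊢
      omega
  have : PT (fun a => ((a, (l a).foldl (s a) (i a)), ([] : List α))) := by
    refine ⟨.comp (.loop .tl body) I, u + (pl + 1) * (2 * M + r.comp M) + .X, fun a => ?_⟩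
    obtain ⟨t, ht, ht'⟩ := hu a
    obtain ⟨v, hv, hv'⟩ := key a (l a) [] rfl
    refine ⟨_, ?_, .comp ht' hv'⟩
    have h1 := (length_le_sz (l a)).trans_le (hpl a)
    have h2 := hv.trans (Nat.mul_le_mul_right _ (Nat.succ_le_succ h1.le))
    simp only [Polynomial.eval_add, Polynomial.eval_mul, Polynomial.eval_X, Polynomial.eval_ofNat,
      Polynomial.eval_comp, Polynomial.eval_one]
    exact add_le_add (add_le_add ht h2) le_rfl
  exact snd (fst this)

/-- A version of `PT.foldl` for steps that add an amount bounded in terms of the context. -/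
theorem foldl_grow {l : Γ → List α} {i : Γ → β} {s : Γ → β → α → β} (hl : PT l) (hi : PT i)
    (hs : PT (fun p : (Γ × β) × α => s p.1.1 p.1.2 p.2))
    (hb : ∃ q : Polynomial ℕ, ∀ a b x, x ∈ l a → sz (s a b x) ≤ sz b + q.eval (sz a)) :
    PT (fun a => (l a).foldl (s a) (i a)) := by
  obtain ⟨q, hq⟩ := hb
  obtain ⟨pl, hpl⟩ := hl.size_bound
  obtain ⟨pi, hpi⟩ := hi.size_bound
  refine foldl hl hi hs ⟨pi + pl * q, fun a l' h => ?_⟩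
  have key : ∀ (k : List α) (b : β), (∀ x ∈ k, x ∈ l a) →
      sz (k.foldl (s a) b) ≤ sz b + k.length * q.eval (sz a) := by
    intro k
    induction k with
    | nil => simp
    | cons x k ih =>
      intro b hk
      have h1 := ih (s a b x) fun y hy => hk y (by simp [hy])
      have h2 := hq a b x (hk x (by simp))
      rw [List.foldl_cons, List.length_cons, Nat.succ_mul]
      omega
  have h1 := key l' (i a) fun x hx => h.subset hx
  have h2 := h.length_le.trans ((length_le_sz (l a)).le.trans (hpl a))
  have h3 := Nat.mul_le_mul_right (q.eval (sz a)) h2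
  have h4 := hpi a
  simp only [Polynomial.eval_add, Polynomial.eval_mul]
  omega

theorem reverse {l : Γ → List α} (hl : PT l) : PT (fun a => (l a).reverse) := by
  obtain ⟨p, hp⟩ := hl.size_bound
  refine (foldl_grow (s := fun _ acc x => x :: acc) hl (const []) (cons (snd id) (snd (fst id)))
    ⟨p + 1, fun a b x hx => ?_⟩).of_eq fun a => by simp
  have := sz_le_of_mem hx
  have := hp a
  rw [sz_cons]
  simp only [Polynomial.eval_add, Polynomial.eval_one]
  omega

theorem append {l m : Γ → List α} (hl : PT l) (hm : PT m) : PT (fun a => l a ++ m a) := by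
  obtain ⟨p, hp⟩ := hl.reverse.size_bound
  refine (foldl_grow (s := fun _ acc x => x :: acc) hl.reverse hm (cons (snd id) (snd (fst id)))
    ⟨p + 1, fun a b x hx => ?_⟩).of_eq fun a => by simp
  have := sz_le_of_mem hx
  have := hp a
  rw [sz_cons]
  simp only [Polynomial.eval_add, Polynomial.eval_one]
  omega

/-- An element is smaller than the list containing it, so the bound depends on the context alone, as
`foldl_grow` demands. -/
theorem size_bound_mem {l : Γ → List α} {g : Γ → α → β} (hl : PT l)
    (hg : PT (fun p : Γ × α => g p.1 p.2)) :
    ∃ p : Polynomial ℕ, ∀ a, ∀ x ∈ l a, sz (g a x) ≤ p.eval (sz a) := by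
  obtain ⟨p, hp⟩ := hl.size_bound
  obtain ⟨r, hr⟩ := hg.size_bound
  refine ⟨r.comp (.X + p), fun a x hx => (hr (a, x)).trans ?_⟩
  rw [Polynomial.eval_comp]
  refine Polynomial.eval_mono_nat r ?_
  have := sz_le_of_mem hx
  have := hp a
  rw [sz_pair]
  simp only [Polynomial.eval_add, Polynomial.eval_X]
  omega

theorem flatMap {l : Γ → List α} {g : Γ → α → List β} (hl : PT l)
    (hg : PT (fun p : Γ × α => g p.1 p.2)) : PT (fun a => (l a).flatMap (g a)) := by
  obtain ⟨p, hp⟩ := size_bound_mem hl hg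
  refine (foldl_grow (s := fun a acc x => acc ++ g a x) hl (const [])
    (append (snd (fst id)) (comp hg (pair (fst (fst id)) (snd id))))
    ⟨p, fun a b x hx => ?_⟩).of_eq fun a => ?_
  · have := sz_append b (g a x)
    have := hp a x hx
    omega
  · rw [List.flatMap_eq_foldl]

theorem map {l : Γ → List α} {g : Γ → α → β} (hl : PT l)
    (hg : PT (fun p : Γ × α => g p.1 p.2)) : PT (fun a => (l a).map (g a)) :=
  (flatMap (g := fun a x => [g a x]) hl (cons hg (const []))).of_eq fun a => by
    induction l a <;> simp_all

theorem filter {l : Γ → List α} {p : Γ → α → Prop} [∀ a, DecidablePred (p a)] (hl : PT l)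
    (hp : PT (fun q : Γ × α => decide (p q.1 q.2))) :
    PT (fun a => (l a).filter (fun x => decide (p a x))) :=
  (flatMap (g := fun a x => if p a x then [x] else []) hl
    (ite hp (cons (snd id) (const [])) (const []))).of_eq fun a => by
      induction l a with
      | nil => rfl
      | cons x k ih => by_cases h : p a x <;> simp_all

theorem exists_mem {l : Γ → List α} {p : Γ → α → Prop} [∀ a, DecidablePred (p a)] (hl : PT l)
    (hp : PT (fun q : Γ × α => decide (p q.1 q.2))) :
    PT (fun a => decide (∃ x ∈ l a, p a x)) :=
  (not (eq_nil (filter hl hp))).of_eq fun a => by simp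

theorem nat_succ {f : Γ → ℕ} (hf : PT f) : PT (fun a => f a + 1) :=
  (cons (const Data.nil) (hf.congr_enc (g := fun a => List.replicate (f a) Data.nil) fun a => by
    simp [enc])).congr_enc fun a => by simp [enc, List.replicate_succ]

theorem nat_replicate {f : Γ → ℕ} (hf : PT f) : PT (fun a => List.replicate (f a) Data.nil) :=
  hf.congr_enc fun a => by simp [enc]

theorem nat_pred {f : Γ → ℕ} (hf : PT f) : PT (fun a => f a - 1) :=
  (tail (nat_replicate hf)).congr_enc fun a => by simp [enc]

theorem length {l : Γ → List α} (hl : PT l) : PT (fun a => (l a).length) :=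
  (map (g := fun _ _ => Data.nil) hl (const _)).congr_enc fun a => by simp [enc]

/-- Repeated predecessor on unary codes. All comparisons of numbers reduce to truncated subtraction.
-/
theorem nat_sub {f g : Γ → ℕ} (hf : PT f) (hg : PT g) : PT (fun a => f a - g a) := by
  refine (foldl_grow (s := fun _ n _ => n - 1) (nat_replicate hg) hf (nat_pred (snd (fst id)))
    ⟨0, fun a b x _ => ?_⟩).of_eq fun a => ?_
  · simp only [sz_nat, Polynomial.eval_zero]; omega
  · generalize f a = m
    induction g a generalizing m with
    | zero => rfl
    | succ n ih => rw [List.replicate_succ, List.foldl_cons, ih]; omega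

theorem nat_eq_zero {f : Γ → ℕ} (hf : PT f) : PT (fun a => decide (f a = 0)) :=
  (eq_nil (nat_replicate hf)).of_eq fun a => by simp

theorem nat_le {f g : Γ → ℕ} (hf : PT f) (hg : PT g) : PT (fun a => decide (f a ≤ g a)) :=
  (nat_eq_zero (nat_sub hf hg)).of_eq fun a => by simp [Nat.sub_eq_zero_iff_le]

theorem nat_lt {f g : Γ → ℕ} (hf : PT f) (hg : PT g) : PT (fun a => decide (f a < g a)) :=
  nat_le (nat_succ hf) hg

theorem nat_eq {f g : Γ → ℕ} (hf : PT f) (hg : PT g) : PT (fun a => decide (f a = g a)) :=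
  (and (nat_le hf hg) (nat_le hg hf)).of_eq fun a => by simp [le_antisymm_iff]

theorem range {f : Γ → ℕ} (hf : PT f) : PT (fun a => List.range (f a)) := by
  obtain ⟨p, hp⟩ := hf.size_bound
  -- The accumulator is its own counter: the next entry is its present length.
  have key : ∀ n, (List.replicate n Data.nil).foldl
      (fun (acc : List ℕ) _ => acc ++ [acc.length]) [] = List.range n := by
    intro n
    induction n with
    | zero => rfl
    | succ n ih => rw [List.replicate_succ', List.foldl_append, ih]; simp [List.range_succ]
  refine (foldl (s := fun _ (acc : List ℕ) _ => acc ++ [acc.length]) (nat_replicate hf) (const [])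
    (append (snd (fst id)) (cons (length (snd (fst id))) (const [])))
    ⟨p * (p + 1) + 1, fun a l' h => ?_⟩).of_eq fun a => key _
  obtain ⟨n, rfl⟩ : ∃ n, l' = List.replicate n Data.nil :=
    ⟨l'.length, List.eq_replicate_of_mem fun b hb => List.eq_of_mem_replicate (h.subset hb)⟩
  have hn : n ≤ f a := by simpa using h.length_le
  rw [key]
  have := hp a
  rw [sz_nat] at this
  refine (sz_le_of_forall (K := p.eval (sz a)) fun x hx => ?_).trans ?_
  · rw [List.mem_range] at hx
    rw [sz_nat]; omega
  · simp only [Polynomial.eval_add, Polynomial.eval_mul, Polynomial.eval_one, List.length_range]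
    gcongr
    omega

theorem drop {f : Γ → ℕ} {l : Γ → List α} (hf : PT f) (hl : PT l) :
    PT (fun a => (l a).drop (f a)) := by
  refine (foldl_grow (s := fun _ k _ => k.tail) (nat_replicate hf) hl (tail (snd (fst id)))
    ⟨0, fun a b x _ => ?_⟩).of_eq fun a => ?_
  · cases b <;> simp [sz_cons, sz_nil]; omega
  · generalize l a = m
    induction f a generalizing m with
    | zero => rfl
    | succ n ih => rw [List.replicate_succ, List.foldl_cons, ih]; simp

theorem getD {f : Γ → ℕ} {l : Γ → List α} {d : Γ → α} (hl : PT l) (hf : PT f) (hd : PT d) :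
    PT (fun a => (l a).getD (f a) (d a)) :=
  (headD (drop hf hl) hd).of_eq fun a => by
    simp [List.getD_eq_getElem?_getD, List.headD_eq_head?_getD]

end PT

/-! ### Equality, membership and loops in polynomial time. -/

/-- Types whose equality can be decided in polynomial time. -/
class PTEq (α : Type) [Enc α] [DecidableEq α] : Prop where
  eq : PT (fun p : α × α => decide (p.1 = p.2))

instance : PTEq ℕ := ⟨PT.nat_eq (.fst .id) (.snd .id)⟩

namespace PT
variable {Γ α β δ : Type} [Enc Γ] [Enc α] [Enc β] [Enc δ]

theorem eq [DecidableEq α] [PTEq α] {f g : Γ → α} [∀ a, Decidable (f a = g a)] (hf : PT f)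
    (hg : PT g) : PT (fun a => decide (f a = g a)) :=
  (comp PTEq.eq (pair hf hg)).of_eq fun a => by rw [Bool.eq_iff_iff]; simp

theorem mem [DecidableEq α] [PTEq α] {f : Γ → α} {l : Γ → List α} [∀ a, Decidable (f a ∈ l a)]
    (hf : PT f) (hl : PT l) : PT (fun a => decide (f a ∈ l a)) :=
  (exists_mem (p := fun a x => x = f a) hl (eq (snd id) (comp hf (fst id)))).of_eq fun a => by
    rw [Bool.eq_iff_iff]; simp

end PT

instance {α β : Type} [Enc α] [Enc β] [DecidableEq α] [DecidableEq β] [PTEq α] [PTEq β] :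
    PTEq (α × β) :=
  ⟨(PT.and (PT.eq (.fst (.fst .id)) (.fst (.snd .id)))
    (PT.eq (.snd (.fst .id)) (.snd (.snd .id)))).of_eq fun p => by simp [Prod.ext_iff]⟩

/-- A while-loop around polynomial-time functions, on a set of states of bounded size. -/
theorem exists_loop {σ : Type} [Enc σ] {go : σ → Prop} [DecidablePred go] {step : σ → σ}
    (hgo : PT (fun s => decide (go s))) (hstep : PT step) :
    ∃ (P : Program) (p : Polynomial ℕ), ∀ (I : σ → Prop) (μ : σ → ℕ) (M : ℕ),
      (∀ s, I s → sz s ≤ M) → (∀ s, I s → go s → I (step s) ∧ μ (step s) < μ s) →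
      ∀ s, I s → ∃ s' t, P.Runs (enc s) (enc s') t ∧ I s' ∧ ¬ go s' ∧
        t ≤ (μ s + 1) * p.eval M := by
  obtain ⟨C, c, hC⟩ := hgo
  obtain ⟨F, f, hF⟩ := hstep
  -- Program and polynomial are fixed before the invariant, the measure and the size bound, because
  -- these will depend on the graph, and the size bound is exponential in its treewidth.
  refine ⟨.loop C F, c + f + .X, fun I μ M hM hI s hs => ?_⟩
  generalize hn : μ s = n
  induction n using Nat.strong_induction_on generalizing s with
  | _ n ih =>
    obtain ⟨t, ht, hrt⟩ := hC s
    have hsM := hM s hs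
    have h1 := Polynomial.eval_mono_nat c hsM
    have h2 := Polynomial.eval_mono_nat f hsM
    simp only [Polynomial.eval_add, Polynomial.eval_X] at ih ⊢
    by_cases h : go s
    · obtain ⟨hI', hμ⟩ := hI s hs h
      obtain ⟨u, hu, hru⟩ := hF s
      obtain ⟨s', v, hv, hIs', hgs', hvt⟩ := ih _ (hn ▸ hμ) _ hI' rfl
      refine ⟨s', _, .loop_step hrt (by simp [h, enc, Data.ofBool]) hru hv, hIs', hgs', ?_⟩
      have h3 := Nat.mul_le_mul_right (c.eval M + f.eval M + M) (show μ (step s) + 1 ≤ n by omega)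
      rw [Nat.succ_mul]
      simp only [sz] at *
      omega
    · refine ⟨s, _, Program.Runs.loop_stop (by simpa [h, enc, Data.ofBool] using hrt), hs, h, ?_⟩
      have h3 := Nat.le_mul_of_pos_left (c.eval M + f.eval M + M) (show 0 < n + 1 by omega)
      simp only [sz] at *
      omega

end SepWidth

namespace SepWidth
open Enc

/-! ### Augmenting paths -/

section Flow
set_option linter.unusedSectionVars false
variable {ν : Type} [DecidableEq ν]

/-- The nodes reached by a list of search-tree edges with root `s`. -/
def reached (s : ν) (R : List (ν × ν)) : List ν := s :: R.map Prod.snd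

/-- Extend the search tree `R` by the edge `e` if that reaches a new node. -/
def searchStep (s : ν) (R : List (ν × ν)) (e : ν × ν) : List (ν × ν) :=
  if e.1 ∈ reached s R ∧ e.2 ∉ reached s R then e :: R else R

/-- A search tree with root `s` in the digraph with edge list `L`, newest edge first. -/
def searchTree (s : ν) (L : List (ν × ν)) : List (ν × ν) :=
  L.foldl (fun R _ => L.foldl (searchStep s) R) []

/-- The residual edges of a flow `F` in the network `L`. -/
def residual (L F : List (ν × ν)) : List (ν × ν) := L.map fun e => if e ∈ F then e.swap else e

/-- Push one unit of flow along the residual edge `e`. -/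
def pushEdge (F : List (ν × ν)) (e : ν × ν) : List (ν × ν) :=
  if e.swap ∈ F then F.filter (fun f => decide (f ≠ e.swap)) else e :: F

/-- Push one unit of flow along `e` if `e` ends in the current node, and go to its other end. -/
def pushStep (c : ν × List (ν × ν)) (e : ν × ν) : ν × List (ν × ν) :=
  if e.2 = c.1 then (e.1, pushEdge c.2 e) else c

/-- Augment the flow `F` along a residual path from `s` to `t`, if there is one. -/
def augment (L : List (ν × ν)) (s t : ν) (F : List (ν × ν)) : List (ν × ν) :=
  ((searchTree s (residual L F)).foldl pushStep (t, F)).2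

/-- `R` lists the edges of a search tree, newest first. -/
inductive IsSearchTree (s : ν) (L : List (ν × ν)) : List (ν × ν) → Prop
  | nil : IsSearchTree s L []
  | cons {e R} : e ∈ L → e.1 ∈ reached s R → e.2 ∉ reached s R → IsSearchTree s L R →
      IsSearchTree s L (e :: R)

theorem reached_cons (s : ν) (e : ν × ν) (R : List (ν × ν)) (x : ν) :
    x ∈ reached s (e :: R) ↔ x = e.2 ∨ x ∈ reached s R := by
  simp [reached]; tauto

/-- Without a fixed point by time `N`, the measure would have grown `N + 1` times. This bounds both
the passes of the graph search and the number of augmentations. -/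
theorem iterate_fixed {σ : Type*} (f : σ → σ) (m : σ → ℕ) (N : ℕ) (x : σ)
    (hlt : ∀ k, f (f^[k] x) = f^[k] x ∨ m (f^[k] x) < m (f (f^[k] x)))
    (hN : ∀ k, m (f^[k] x) ≤ N) : f (f^[N] x) = f^[N] x := by
  by_contra hne
  have stay : ∀ k j, f (f^[k] x) = f^[k] x → f^[k + j] x = f^[k] x := by
    intro k j h
    rw [add_comm, Function.iterate_add_apply, Function.iterate_fixed h]
  have lt : ∀ k ≤ N, m (f^[k] x) < m (f (f^[k] x)) := by
    intro k hk
    refine (hlt k).resolve_left fun h => hne ?_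
    obtain ⟨j, rfl⟩ := Nat.exists_eq_add_of_le hk
    rw [stay k j h, h]
  have grow : ∀ k ≤ N + 1, k ≤ m (f^[k] x) := by
    intro k
    induction k with
    | zero => simp
    | succ k ih =>
      intro hk
      have := ih (by omega)
      have := lt k (by omega)
      rw [Function.iterate_succ_apply']
      omega
  have := grow (N + 1) le_rfl
  have := hN (N + 1)
  omega

theorem IsSearchTree.nodup_subset {s : ν} {L R : List (ν × ν)} (h : IsSearchTree s L R) :
    R.Nodup ∧ R ⊆ L := by
  induction h with
  | nil => simp
  | @cons e R he _ h2 _ ih =>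
    refine ⟨List.nodup_cons.2 ⟨fun h => h2 ?_, ih.1⟩, List.cons_subset.2 ⟨he, ih.2⟩⟩
    exact List.mem_cons_of_mem _ (List.mem_map_of_mem h)

theorem IsSearchTree.foldl {s : ν} {L R : List (ν × ν)} (h : IsSearchTree s L R)
    {K : List (ν × ν)} (hK : K ⊆ L) : IsSearchTree s L (K.foldl (searchStep s) R) := by
  induction K generalizing R with
  | nil => exact h
  | cons e K ih =>
    rw [List.cons_subset] at hK
    refine ih ?_ hK.2
    unfold searchStep
    split
    next h' => exact .cons hK.1 h'.1 h'.2 h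
    next => exact h

theorem searchStep_length (s : ν) (R : List (ν × ν)) (e : ν × ν) :
    searchStep s R e = R ∨ R.length < (searchStep s R e).length := by
  unfold searchStep
  split <;> simp

theorem search_length_le (s : ν) (K R : List (ν × ν)) :
    R.length ≤ (K.foldl (searchStep s) R).length := by
  induction K generalizing R with
  | nil => simp
  | cons e K ih =>
    refine le_trans ?_ (ih _)
    rcases searchStep_length s R e with h | h
    · rw [h]
    · exact h.le

/-- Either an earlier edge of the pass already extends the tree, or the tree is unchanged when `e`
has its turn, and then `e` extends it. -/
theorem search_length_lt {s : ν} {K R : List (ν × ν)} {e : ν × ν} (he : e ∈ K)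
    (h1 : e.1 ∈ reached s R) (h2 : e.2 ∉ reached s R) :
    R.length < (K.foldl (searchStep s) R).length := by
  induction K with
  | nil => simp at he
  | cons x K ih =>
    rw [List.foldl_cons]
    rcases searchStep_length s R x with h | h
    · rw [h]
      rcases List.mem_cons.1 he with rfl | he
      · exfalso
        simp [searchStep, h1, h2] at h
      · exact ih he
    · exact h.trans_le (search_length_le _ _ _)

theorem search_eq_or_lt (s : ν) (K R : List (ν × ν)) :
    K.foldl (searchStep s) R = R ∨ R.length < (K.foldl (searchStep s) R).length := by
  induction K with
  | nil => simp
  | cons x K ih =>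
    rw [List.foldl_cons]
    rcases searchStep_length s R x with h | h
    · rwa [h]
    · exact .inr (h.trans_le (search_length_le _ _ _))

theorem searchTree_eq (s : ν) (L : List (ν × ν)) :
    searchTree s L = (fun R => L.foldl (searchStep s) R)^[L.length] [] := by
  rw [searchTree, List.foldl_const]

theorem isSearchTree_iterate (s : ν) (L : List (ν × ν)) (k : ℕ) :
    IsSearchTree s L ((fun R => L.foldl (searchStep s) R)^[k] []) := by
  induction k with
  | zero => exact .nil
  | succ k ih =>
    rw [Function.iterate_succ_apply']
    exact ih.foldl (List.Subset.refl _)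

theorem isSearchTree_searchTree (s : ν) (L : List (ν × ν)) : IsSearchTree s L (searchTree s L) :=
  searchTree_eq s L ▸ isSearchTree_iterate s L _

/-- A search tree has at most `L.length` edges, so `L.length` passes reach a fixed point; an edge
leaving the reached set would make one more pass enlarge the tree. -/
theorem searchTree_closed (s : ν) (L : List (ν × ν)) {e : ν × ν} (he : e ∈ L)
    (h1 : e.1 ∈ reached s (searchTree s L)) : e.2 ∈ reached s (searchTree s L) := by
  by_contra h2
  have h3 := search_length_lt he h1 h2
  have := iterate_fixed (fun R => L.foldl (searchStep s) R) List.length L.length []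
    (fun k => search_eq_or_lt _ _ _) fun k => by
      have := (isSearchTree_iterate s L k).nodup_subset
      exact (this.1.subperm this.2).length_le
  simp only [← searchTree_eq] at this
  rw [this] at h3
  exact lt_irrefl _ h3

open Classical in
/-- The net contribution of the edge `e` to the flow out of `X`. -/
noncomputable def edgeOut (X : Set ν) (e : ν × ν) : ℤ :=
  (if e.1 ∈ X then 1 else 0) - (if e.2 ∈ X then 1 else 0)

/-- The net flow out of `X`. -/
noncomputable def flowOut (F : List (ν × ν)) (X : Set ν) : ℤ := (F.map (edgeOut X)).sum

/-- `F` is a flow of value `q` from `s` to `t` in the network `L` with unit capacities. -/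
structure IsFlow (L : List (ν × ν)) (s t : ν) (F : List (ν × ν)) (q : ℤ) : Prop where
  subset : F ⊆ L
  nodup : F.Nodup
  flowOut_eq : ∀ X : Set ν, s ∈ X → t ∉ X → flowOut F X = q

theorem edgeOut_swap (X : Set ν) (e : ν × ν) : edgeOut X e.swap = - edgeOut X e := by
  simp [edgeOut]

/-- `F₀` is the flow whose residual network was searched and `F` the partly augmented one; they need
to agree only on `e` and its reverse. Cancelling the reverse edge and adding `e` change every net
flow by the same amount. -/
theorem pushEdge_spec {L F F₀ : List (ν × ν)} {e : ν × ν} (hF : F ⊆ L) (hn : F.Nodup)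
    (he : e ∈ residual L F₀) (h1 : e ∈ F ↔ e ∈ F₀) (h2 : e.swap ∈ F ↔ e.swap ∈ F₀) :
    pushEdge F e ⊆ L ∧ (pushEdge F e).Nodup ∧
      (∀ X, flowOut (pushEdge F e) X = flowOut F X + edgeOut X e) ∧
      ∀ f, f ≠ e → f ≠ e.swap → (f ∈ pushEdge F e ↔ f ∈ F) := by
  unfold pushEdge
  split
  next h =>
    refine ⟨fun x hx => hF (List.mem_filter.1 hx).1, hn.filter _, fun X => ?_, fun f _ hf => ?_⟩
    · have hp := (List.perm_cons_erase h).map (edgeOut X)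
      have hs := hp.sum_eq
      rw [hn.erase_eq_filter] at hs
      have hb : (fun f => decide (f ≠ e.swap)) = (fun f => f != e.swap) := by
        ext f; rw [Bool.eq_iff_iff]; simp
      simp only [flowOut, hb]
      rw [hs, List.map_cons, List.sum_cons, edgeOut_swap]
      ring
    · simp [hf]
  next h =>
    obtain ⟨f, hf, rfl⟩ := List.mem_map.1 he
    by_cases hf0 : f ∈ F₀
    · simp only [hf0, if_true, Prod.swap_swap] at h h2
      simp [h] at h2
    · simp only [hf0, if_false] at h1 ⊢
      rw [iff_false] at h1
      refine ⟨List.cons_subset.2 ⟨hf, hF⟩, List.nodup_cons.2 ⟨h1, hn⟩, fun X => ?_, ?_⟩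
      · simp [flowOut, add_comm]
      · intro g hg _
        simp [hg]

/-- The newest edge of the tree comes first, so the edge leading into the current node is met before
the edge into its parent, and one traversal follows the path back to `s`. A pushed edge ends in a
node that the older edges do not reach, so `F` still agrees with `F₀` on the rest of the tree. The
contributions of the path telescope to that of `(s, c)`. -/
theorem pushStep_foldl {L F₀ : List (ν × ν)} {s : ν} {R : List (ν × ν)}
    (hR : IsSearchTree s (residual L F₀) R) : ∀ (c : ν) (F : List (ν × ν)), c ∈ reached s R →
    F ⊆ L → F.Nodup → (∀ e : ν × ν, e.1 ∈ reached s R → e.2 ∈ reached s R → (e ∈ F ↔ e ∈ F₀)) →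
    (R.foldl pushStep (c, F)).2 ⊆ L ∧ (R.foldl pushStep (c, F)).2.Nodup ∧
      ∀ X, flowOut (R.foldl pushStep (c, F)).2 X = flowOut F X + edgeOut X (s, c) := by
  induction hR with
  | nil =>
    intro c F hc hF hn _
    obtain rfl : c = s := by simpa [reached] using hc
    exact ⟨hF, hn, fun X => by simp [edgeOut]⟩
  | @cons e R he h1 h2 _ ih =>
    intro c F hc hF hn hag
    rw [List.foldl_cons]
    by_cases hec : e.2 = c
    · have hst : pushStep (c, F) e = (e.1, pushEdge F e) := by simp [pushStep, hec]
      have he1 : e.1 ∈ reached s (e :: R) := (reached_cons ..).2 (.inr h1)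
      have he2 : e.2 ∈ reached s (e :: R) := (reached_cons ..).2 (.inl rfl)
      obtain ⟨p1, p2, p3, p4⟩ := pushEdge_spec hF hn he (hag e he1 he2) (hag e.swap he2 he1)
      rw [hst]
      obtain ⟨q1, q2, q3⟩ := ih e.1 (pushEdge F e) h1 p1 p2 fun f hf1 hf2 => by
        rw [p4 f (by rintro rfl; exact h2 hf2) (by rintro rfl; exact h2 hf1)]
        exact hag f ((reached_cons ..).2 (.inr hf1)) ((reached_cons ..).2 (.inr hf2))
      refine ⟨q1, q2, fun X => ?_⟩
      rw [q3, p3, ← hec]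
      simp only [edgeOut]
      ring
    · have hst : pushStep (c, F) e = (c, F) := by simp [pushStep, hec]
      rw [hst]
      rcases (reached_cons ..).1 hc with rfl | hc
      · exact absurd rfl hec
      · exact ih c F hc hF hn fun f hf1 hf2 =>
          hag f ((reached_cons ..).2 (.inr hf1)) ((reached_cons ..).2 (.inr hf2))

theorem IsFlow.augment {L F : List (ν × ν)} {s t : ν} {q : ℤ} (h : IsFlow L s t F q)
    (ht : t ∈ reached s (searchTree s (residual L F))) :
    IsFlow L s t (augment L s t F) (q + 1) := by
  obtain ⟨h1, h2, h3⟩ := pushStep_foldl (isSearchTree_searchTree s (residual L F)) t F ht h.subset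
    h.nodup fun _ _ _ => Iff.rfl
  refine ⟨h1, h2, fun X hs ht => ?_⟩
  rw [augment.eq_1, h3, h.flowOut_eq X hs ht]
  simp [edgeOut, hs, ht]

/-- No edge of the tree ends in `t`, so the traversal never leaves `t` and pushes nothing. -/
theorem augment_eq_self {L F : List (ν × ν)} {s t : ν}
    (ht : t ∉ reached s (searchTree s (residual L F))) : augment L s t F = F := by
  have : ∀ R : List (ν × ν), t ∉ reached s R → R.foldl pushStep (t, F) = (t, F) := by
    intro R
    induction R with
    | nil => simp
    | cons e R ih =>
      intro h
      rw [reached_cons, not_or] at h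
      rw [List.foldl_cons, pushStep, if_neg (Ne.symm h.1), ih h.2]
  rw [augment, this _ ht]

/-- Repeated augmentation produces a flow without residual path from `s` to `t`. -/
theorem exists_isFlow_iterate {L : List (ν × ν)} {s t : ν} {N : ℕ}
    (hN : ∀ F q, IsFlow L s t F q → q ≤ N) :
    ∃ q, IsFlow L s t ((augment L s t)^[N] []) q ∧
      t ∉ reached s (searchTree s (residual L ((augment L s t)^[N] []))) := by
  classical
  have hflow : ∀ k, ∃ q, IsFlow L s t ((augment L s t)^[k] []) q ∧ 0 ≤ q := by
    intro k
    induction k with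
    | zero => exact ⟨0, ⟨by simp, by simp, by simp [flowOut]⟩, le_rfl⟩
    | succ k ih =>
      obtain ⟨q, hq, h0⟩ := ih
      rw [Function.iterate_succ_apply']
      by_cases ht : t ∈ reached s (searchTree s (residual L ((augment L s t)^[k] [])))
      · exact ⟨q + 1, hq.augment ht, by omega⟩
      · exact ⟨q, by rwa [augment_eq_self ht], h0⟩
  -- For `t = s` the condition on cuts is vacuous and the empty flow would have every value, against
  -- `hN`. Otherwise the cut `{s}` measures the value.
  by_cases hst : t = s
  · subst hst
    have h0 : IsFlow L t t [] (N + 1) :=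
      ⟨by simp, by simp, fun X h h' => absurd h h'⟩
    have := hN _ _ h0
    omega
  have hfix := iterate_fixed (augment L s t) (fun F => (flowOut F {s}).toNat) N [] (fun k => by
      obtain ⟨q, hq, h0⟩ := hflow k
      by_cases ht : t ∈ reached s (searchTree s (residual L ((augment L s t)^[k] [])))
      · right
        rw [hq.flowOut_eq {s} rfl hst, (hq.augment ht).flowOut_eq {s} rfl hst]
        omega
      · exact .inl (augment_eq_self ht)) fun k => by
      obtain ⟨q, hq, h0⟩ := hflow k
      rw [hq.flowOut_eq {s} rfl hst]
      have := hN _ _ hq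
      omega
  obtain ⟨q, hq, h0⟩ := hflow N
  refine ⟨q, hq, fun ht => ?_⟩
  have h1 := (hq.augment ht).flowOut_eq {s} rfl hst
  rw [hfix, hq.flowOut_eq {s} rfl hst] at h1
  omega

open Classical in
-- Weak duality for unit capacities: edges that enter `X` contribute negatively. Equality holds when
-- no flow edge enters `X`, which is the next lemma.
theorem flowOut_le (F : List (ν × ν)) (X : Set ν) :
    flowOut F X ≤ (F.filter fun e => decide (e.1 ∈ X ∧ e.2 ∉ X)).length := by
  induction F with
  | nil => simp [flowOut]
  | cons e F ih =>
    simp only [flowOut, List.map_cons, List.sum_cons, List.filter_cons] at ih ⊢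
    by_cases h1 : e.1 ∈ X <;> by_cases h2 : e.2 ∈ X <;> simp [edgeOut, h1, h2] at ih ⊢ <;> omega

open Classical in
theorem flowOut_eq_length (F : List (ν × ν)) (X : Set ν)
    (h : ∀ e ∈ F, e.2 ∈ X → e.1 ∈ X) :
    flowOut F X = (F.filter fun e => decide (e.1 ∈ X ∧ e.2 ∉ X)).length := by
  induction F with
  | nil => simp [flowOut]
  | cons e F ih =>
    have ih := ih fun f hf => h f (by simp [hf])
    have he := h e (by simp)
    simp only [flowOut, List.map_cons, List.sum_cons, List.filter_cons] at ih ⊢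
    by_cases h1 : e.1 ∈ X <;> by_cases h2 : e.2 ∈ X <;> simp [edgeOut, h1, h2] at he ih ⊢ <;> omega

end Flow

/-! ### Minimum vertex separators -/

/-- The network for the vertex separators between `A` and `B` in the graph with edge list `E`,
restricted to `U`: every vertex `v` is split into `(v, 0)` and `(v, 1)`; the source is `(0, 2)`
and the sink is `(0, 3)`. -/
def network (E : List (ℕ × ℕ)) (U A B : List ℕ) : List ((ℕ × ℕ) × (ℕ × ℕ)) :=
  A.map (fun a => ((0, 2), (a, 0))) ++ (U.map (fun v => ((v, 0), (v, 1))) ++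
    ((E.filter (fun e => decide (e.1 ∈ U ∧ e.2 ∈ U))).map (fun e => ((e.1, 1), (e.2, 0))) ++
      B.map (fun b => ((b, 1), (0, 3)))))

/-- A maximum flow in the network. -/
def maxFlow (E : List (ℕ × ℕ)) (U A B : List ℕ) : List ((ℕ × ℕ) × (ℕ × ℕ)) :=
  U.foldl (fun F _ => augment (network E U A B) (0, 2) (0, 3) F) []

/-- The nodes that are reachable from the source in the residual network of a maximum flow. -/
def sourceSide (E : List (ℕ × ℕ)) (U A B : List ℕ) : List (ℕ × ℕ) :=
  reached (0, 2) (searchTree (0, 2) (residual (network E U A B) (maxFlow E U A B)))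

/-- The vertex charged for a network edge in a cut. -/
def edgeVertex (e : (ℕ × ℕ) × (ℕ × ℕ)) : ℕ := if e.1.2 = 2 then e.2.1 else e.1.1

/-- A minimum vertex separator between `A` and `B` in `U`. -/
def minCut (E : List (ℕ × ℕ)) (U A B : List ℕ) : List ℕ :=
  U.filter fun v => decide (v ∈ ((network E U A B).filter fun e =>
    decide (e.1 ∈ sourceSide E U A B ∧ e.2 ∉ sourceSide E U A B)).map edgeVertex)

/-- The side of `A` of the minimum vertex separator. -/
def cutSide (E : List (ℕ × ℕ)) (U A B : List ℕ) : List ℕ :=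
  U.filter fun v => decide (v ∉ minCut E U A B ∧ (v, 1) ∈ sourceSide E U A B)

theorem mem_network {E : List (ℕ × ℕ)} {U A B : List ℕ} {e : (ℕ × ℕ) × (ℕ × ℕ)} :
    e ∈ network E U A B ↔ (∃ a ∈ A, e = ((0, 2), (a, 0))) ∨ (∃ v ∈ U, e = ((v, 0), (v, 1))) ∨
      (∃ u ∈ U, ∃ v ∈ U, (u, v) ∈ E ∧ e = ((u, 1), (v, 0))) ∨ ∃ b ∈ B, e = ((b, 1), (0, 3)) := by
  simp only [network, List.mem_append, List.mem_map, List.mem_filter, decide_eq_true_eq,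
    Prod.exists]
  constructor
  · rintro (⟨a, h, rfl⟩ | ⟨v, h, rfl⟩ | ⟨u, v, ⟨h, h1, h2⟩, rfl⟩ | ⟨b, h, rfl⟩)
    · exact .inl ⟨a, h, rfl⟩
    · exact .inr (.inl ⟨v, h, rfl⟩)
    · exact .inr (.inr (.inl ⟨u, h1, v, h2, h, rfl⟩))
    · exact .inr (.inr (.inr ⟨b, h, rfl⟩))
  · rintro (⟨a, h, rfl⟩ | ⟨v, h, rfl⟩ | ⟨u, h1, v, h2, h, rfl⟩ | ⟨b, h, rfl⟩)
    · exact .inl ⟨a, h, rfl⟩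
    · exact .inr (.inl ⟨v, h, rfl⟩)
    · exact .inr (.inr (.inl ⟨u, v, ⟨h, h1, h2⟩, rfl⟩))
    · exact .inr (.inr (.inr ⟨b, h, rfl⟩))

/-- `S` separates `A` from `B` in `U`, where `P` contains the side of `A`. -/
structure SeparatesLists (E : List (ℕ × ℕ)) (U A B S : List ℕ) (P : Set ℕ) : Prop where
  left : ∀ a ∈ A, a ∈ P ∨ a ∈ S
  right : ∀ b ∈ B, b ∉ P
  step : ∀ u ∈ U, ∀ v ∈ U, (u, v) ∈ E → u ∈ P → v ∈ P ∨ v ∈ S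

/-- A vertex separator gives a cut of the network that only the inner edges of the split vertices of
`S` can cross. -/
theorem IsFlow.le_length {E : List (ℕ × ℕ)} {U A B S : List ℕ} {P : Set ℕ}
    (h : SeparatesLists E U A B S P) {F : List ((ℕ × ℕ) × (ℕ × ℕ))} {q : ℤ}
    (hF : IsFlow (network E U A B) (0, 2) (0, 3) F q) : q ≤ S.length := by
  classical
  -- Vertices of `P` lie in the cut with both copies, vertices of `S` outside `P` with their
  -- entrance only.
  let X : Set (ℕ × ℕ) :=
    {x | x = (0, 2) ∨ (x.2 = 0 ∧ (x.1 ∈ P ∨ x.1 ∈ S)) ∨ (x.2 = 1 ∧ x.1 ∈ P)}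
  rw [← hF.flowOut_eq X (by simp [X]) (by simp [X])]
  refine (flowOut_le F X).trans ?_
  rw [Nat.cast_le, ← S.length_map (f := fun v => (((v, 0), (v, 1)) : (ℕ × ℕ) × (ℕ × ℕ)))]
  refine ((hF.nodup.filter _).subperm fun e he => ?_).length_le
  simp only [List.mem_filter, decide_eq_true_eq] at he
  obtain ⟨he, h1, h2⟩ := he
  rw [List.mem_map]
  rcases mem_network.1 (hF.subset he) with
    ⟨a, ha, rfl⟩ | ⟨v, hv, rfl⟩ | ⟨u, hu, v, hv, huv, rfl⟩ | ⟨b, hb, rfl⟩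
  · have := h.left a ha
    simp [X, this] at h2
  · refine ⟨v, ?_, rfl⟩
    simp [X] at h1 h2
    tauto
  · have := h.step u hu v hv huv
    simp [X] at h1 h2
    tauto
  · have := h.right b hb
    simp [X, this] at h1

/-- `U` itself separates, with nothing on the side of `A`, so `U.length` augmentations suffice.
Since the source side is closed under residual edges, no flow edge enters it, and every network edge
that leaves it carries flow. -/
theorem sourceSide_spec (E : List (ℕ × ℕ)) (U A B : List ℕ) (hA : A ⊆ U) :
    ((0, 2) ∈ sourceSide E U A B ∧ (0, 3) ∉ sourceSide E U A B) ∧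
    ∃ F q, IsFlow (network E U A B) (0, 2) (0, 3) F q ∧
      flowOut F {x | x ∈ sourceSide E U A B} = q ∧
      (∀ e ∈ F, e.2 ∈ sourceSide E U A B → e.1 ∈ sourceSide E U A B) ∧
      ∀ e ∈ network E U A B, e.1 ∈ sourceSide E U A B → e.2 ∉ sourceSide E U A B → e ∈ F := by
  have hsep : SeparatesLists E U A B U ∅ := ⟨fun a ha => .inr (hA ha), by simp, by simp⟩
  obtain ⟨q, hq, ht⟩ := exists_isFlow_iterate (N := U.length) fun F q hF => hF.le_length hsep
  have hF : maxFlow E U A B = (augment (network E U A B) (0, 2) (0, 3))^[U.length] [] := by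
    rw [maxFlow, List.foldl_const]
  rw [← hF] at hq ht
  have hs : (0, 2) ∈ sourceSide E U A B := by simp [sourceSide, reached]
  refine ⟨⟨hs, ht⟩, _, q, hq, hq.flowOut_eq _ hs ht, fun e he h2 => ?_, fun e he h1 h2 => ?_⟩
  · have hr : e.swap ∈ residual (network E U A B) (maxFlow E U A B) :=
      List.mem_map.2 ⟨e, hq.subset he, by simp [he]⟩
    exact searchTree_closed _ _ hr h2
  · by_contra hn
    have hr : e ∈ residual (network E U A B) (maxFlow E U A B) :=
      List.mem_map.2 ⟨e, he, by simp [hn]⟩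
    exact h2 (searchTree_closed _ _ hr h1)

theorem mem_minCut {E : List (ℕ × ℕ)} {U A B : List ℕ} {e : (ℕ × ℕ) × (ℕ × ℕ)}
    (he : e ∈ network E U A B) (h1 : e.1 ∈ sourceSide E U A B) (h2 : e.2 ∉ sourceSide E U A B)
    (hU : edgeVertex e ∈ U) : edgeVertex e ∈ minCut E U A B := by
  rw [minCut, List.mem_filter, decide_eq_true_eq]
  exact ⟨hU, List.mem_map_of_mem (List.mem_filter.2 ⟨he, by simp [h1, h2]⟩)⟩

/-- All network edges have capacity one, so any of them may cross the cut, not only the inner edges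
of split vertices. Each crossing edge is charged to one of its vertices by `edgeVertex`; a violation
of separation would be a crossing edge whose vertex was not charged. -/
theorem separatesLists_minCut (E : List (ℕ × ℕ)) (U A B : List ℕ) (hA : A ⊆ U) (hB : B ⊆ U) :
    SeparatesLists E U A B (minCut E U A B) {v | v ∈ cutSide E U A B} := by
  obtain ⟨⟨hs, ht⟩, -⟩ := sourceSide_spec E U A B hA
  have hin : ∀ v ∈ U, (v, 0) ∈ sourceSide E U A B → v ∈ cutSide E U A B ∨ v ∈ minCut E U A B := by
    intro v hv h0
    by_cases hc : v ∈ minCut E U A B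
    · exact .inr hc
    refine .inl (List.mem_filter.2 ⟨hv, ?_⟩)
    rw [decide_eq_true_eq]
    refine ⟨hc, ?_⟩
    by_contra h1
    exact hc (mem_minCut (e := ((v, 0), (v, 1))) (mem_network.2 (.inr (.inl ⟨v, hv, rfl⟩)))
      h0 h1 hv)
  have hside : ∀ v ∈ cutSide E U A B, v ∉ minCut E U A B ∧ (v, 1) ∈ sourceSide E U A B := by
    intro v hv
    simpa [cutSide] using (List.mem_filter.1 hv).2
  refine ⟨fun a ha => ?_, fun b hb hP => ?_, fun u hu v hv huv hP => ?_⟩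
  · by_cases hc : a ∈ minCut E U A B
    · exact .inr hc
    refine hin a (hA ha) ?_
    by_contra h1
    exact hc (mem_minCut (e := ((0, 2), (a, 0))) (mem_network.2 (.inl ⟨a, ha, rfl⟩)) hs h1 (hA ha))
  · obtain ⟨h1, h2⟩ := hside b hP
    exact h1 (mem_minCut (e := ((b, 1), (0, 3)))
      (mem_network.2 (.inr (.inr (.inr ⟨b, hb, rfl⟩)))) h2 ht (hB hb))
  · obtain ⟨h1, h2⟩ := hside u hP
    refine hin v hv ?_
    by_contra h3
    exact h1 (mem_minCut (e := ((u, 1), (v, 0)))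
      (mem_network.2 (.inr (.inr (.inl ⟨u, hu, v, hv, huv, rfl⟩)))) h2 h3 hu)

/-- Each cut vertex is charged for a saturated crossing edge, so there are at most as many as the
value of the flow, which weak duality bounds by `S.length`. -/
theorem minCut_length_le {E : List (ℕ × ℕ)} {U A B S : List ℕ} {P : Set ℕ} (hU : U.Nodup)
    (hA : A ⊆ U) (h : SeparatesLists E U A B S P) : (minCut E U A B).length ≤ S.length := by
  classical
  obtain ⟨-, F, q, hF, hq, hback, hcross⟩ := sourceSide_spec E U A B hA
  have h1 := hF.le_length h
  rw [← hq, flowOut_eq_length _ _ hback, Nat.cast_le] at h1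
  refine le_trans ?_ h1
  rw [← List.length_map (f := edgeVertex)]
  refine ((hU.filter _).subperm fun v hv => ?_).length_le
  rw [List.mem_filter, decide_eq_true_eq, List.mem_map] at hv
  obtain ⟨-, e, he, rfl⟩ := hv
  rw [List.mem_filter, decide_eq_true_eq] at he
  exact List.mem_map_of_mem (List.mem_filter.2 ⟨hcross e he.1 he.2.1 he.2.2, by simpa using he.2⟩)

end SepWidth

namespace SepWidth
open Enc

/-! ### The algorithm -/

/-- The vertices in `N` outside `U` that are adjacent to a vertex of `U`. -/
def boundaryList (N : List ℕ) (E : List (ℕ × ℕ)) (U : List ℕ) : List ℕ :=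
  N.filter fun u => decide (u ∉ U ∧ ∃ e ∈ E, e.1 = u ∧ e.2 ∈ U)

/-- The vertices in `U` that are adjacent to a vertex of `A`. -/
def neighbours (E : List (ℕ × ℕ)) (U A : List ℕ) : List ℕ :=
  U.filter fun v => decide (∃ e ∈ E, e.1 ∈ A ∧ e.2 = v)

/-- The elements of `W` to which the word `w` assigns the letter `c`. -/
def colourClass (W w : List ℕ) (c : ℕ) : List ℕ :=
  ((W.zip w).filter fun p => decide (p.2 = c)).map Prod.fst

/-- All extensions by one letter of the words in `T`. -/
def extendWords (T : List (List ℕ)) : List (List ℕ) := T.flatMap fun w => [0 :: w, 1 :: w, 2 :: w]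

/-- Try to separate in `U` the two parts of the boundary `W` that the word `w` describes. The
result contains the separator and the first of the two sides, if they are suitable. -/
def trySplit (E : List (ℕ × ℕ)) (U W w : List ℕ) : List (List ℕ × List ℕ) :=
  if ¬ colourClass W w 0 = [] ∧ ¬ colourClass W w 1 = [] ∧
      (minCut E U (neighbours E U (colourClass W w 0))
        (neighbours E U (colourClass W w 1))).length ≤ (colourClass W w 0).length ∧
      (minCut E U (neighbours E U (colourClass W w 0))
        (neighbours E U (colourClass W w 1))).length ≤ (colourClass W w 1).length then
    [(minCut E U (neighbours E U (colourClass W w 0)) (neighbours E U (colourClass W w 1)),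
      cutSide E U (neighbours E U (colourClass W w 0)) (neighbours E U (colourClass W w 1)))]
  else []

/-- The tasks of the algorithm: `(false, U, [])` asks for a decomposition of `U` and
`(true, U, S)` for the combination of two decompositions at a node labelled `(U, S)`. -/
abbrev Task := Bool × (List ℕ × List ℕ)

/-- The states of the algorithm: the graph, as lists of vertices and edges, the current bound on
the width with all words of this length, the tasks, and the decompositions found so far. -/
abbrev State := (List ℕ × List (ℕ × ℕ)) × ((ℕ × List (List ℕ)) × (List Task × List Data))

/-- The membership bits of `U` for the vertices in `N`. -/
def bits (N U : List ℕ) : List Bool := N.map fun v => decide (v ∈ U)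

/-- The code of a node of a decomposition. -/
def nodeData (N U S : List ℕ) (l r : Data) : Data :=
  .cons (.cons (enc (bits N U)) (enc (bits N S))) (.cons l r)

/-- The tasks that replace the task to decompose `U` after separating `U` by `S` into `X` and `Y`. -/
def splitTasks (U S X Y : List ℕ) (rest : List Task) : List Task :=
  (false, X, []) :: (false, Y, []) :: (true, U, S) :: rest

/-- Process the task to decompose `U`. -/
def solveStep (N : List ℕ) (E : List (ℕ × ℕ)) (b : ℕ) (T : List (List ℕ)) (todo : List Task)
    (done : List Data) (U : List ℕ) : State :=
  if U = [] then ((N, E), ((b, T), (todo.tail, Data.nil :: done)))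
  else if (boundaryList N E U).length < b then
    ((N, E), ((b, T), (splitTasks U [U.headD 0] U.tail [] todo.tail, done)))
  else if T.flatMap (trySplit E U (boundaryList N E U)) = [] then
    ((N, E), ((b + 1 + 1 + 1, extendWords (extendWords (extendWords T))), (todo, done)))
  else
    ((N, E), ((b, T), (splitTasks U
      ((T.flatMap (trySplit E U (boundaryList N E U))).headD ([], [])).1
      ((T.flatMap (trySplit E U (boundaryList N E U))).headD ([], [])).2
      (U.filter fun v => decide
        (v ∉ ((T.flatMap (trySplit E U (boundaryList N E U))).headD ([], [])).1 ∧
        v ∉ ((T.flatMap (trySplit E U (boundaryList N E U))).headD ([], [])).2)) todo.tail, done)))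

/-- One step of the algorithm. -/
def step (s : State) : State :=
  if (s.2.2.1.headD (false, [], [])).1 = true then
    (s.1, (s.2.1, (s.2.2.1.tail,
      nodeData s.1.1 (s.2.2.1.headD (false, [], [])).2.1 (s.2.2.1.headD (false, [], [])).2.2
        (s.2.2.2.tail.headD .nil) (s.2.2.2.headD .nil) :: s.2.2.2.tail.tail)))
  else solveStep s.1.1 s.1.2 s.2.1.1 s.2.1.2 s.2.2.1 s.2.2.2 (s.2.2.1.headD (false, [], [])).2.1

/-- The edges of a graph given by its adjacency matrix. -/
def edgeList (M : List (List Bool)) : List (ℕ × ℕ) :=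
  (List.range M.length).flatMap fun i =>
    ((List.range M.length).filter fun j => decide ((M.getD i []).getD j false = true)).map
      fun j => (i, j)

/-- The initial state for a graph given by its adjacency matrix. -/
def initialState (M : List (List Bool)) : State :=
  ((List.range M.length, edgeList M),
    ((0, [[]]), ([(false, List.range M.length, [])], [])))

/-! ### The algorithm takes polynomially many steps on each task -/

theorem sz_foldl_le {α β : Type} [Enc α] [Enc β] {f : β → α → β} {l : List α} {c : ℕ}
    (h : ∀ b, ∀ x ∈ l, sz (f b x) ≤ sz b + c) (b : β) :
    sz (l.foldl f b) ≤ sz b + l.length * c := by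
  induction l generalizing b with
  | nil => simp
  | cons x l ih =>
    have h1 := ih (fun b x hx => h b x (by simp [hx])) (f b x)
    have h2 := h b x (by simp)
    rw [List.foldl_cons, List.length_cons, Nat.succ_mul]
    omega

section
variable {ν : Type} [Enc ν] [DecidableEq ν]

theorem sz_searchStep_le (s : ν) (R : List (ν × ν)) (e : ν × ν) :
    sz (searchStep s R e) ≤ sz R + (sz e + 1) := by
  unfold searchStep
  split
  · rw [sz_cons]; omega
  · omega

theorem sz_pushStep_le (c : ν × List (ν × ν)) (e : ν × ν) :
    sz (pushStep c e) ≤ sz c + (2 * sz e + 1) := by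
  obtain ⟨c, F⟩ := c
  obtain ⟨x, y⟩ := e
  unfold pushStep pushEdge
  simp only
  split
  · split
    · have := sz_filter_le (fun f => decide (f ≠ (x, y).swap)) F
      simp only [sz_pair] at *
      omega
    · simp only [sz_pair, sz_cons] at *
      omega
  · simp only [sz_pair] at *
    omega

/-- The search tree has at most as many edges as `L`, and each push adds at most one edge. The
growth is independent of `F`, so iterating the augmentation keeps sizes polynomial. -/
theorem sz_augment_le (L : List (ν × ν)) (s t : ν) (F : List (ν × ν)) :
    sz (augment L s t F) ≤ sz F + (sz t + 1 + sz L * (2 * sz L + 1)) := by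
  have h1 := (isSearchTree_searchTree s (residual L F)).nodup_subset
  have h2 : (searchTree s (residual L F)).length ≤ sz L := by
    have h3 := (h1.1.subperm h1.2).length_le
    rw [residual, List.length_map] at h3
    exact h3.trans (length_le_sz L).le
  have h4 := sz_foldl_le (f := pushStep) (l := searchTree s (residual L F)) (c := 2 * sz L + 1)
    (fun b e he => by
      obtain ⟨f, hf, rfl⟩ := List.mem_map.1 (h1.2 he)
      have h5 := sz_le_of_mem hf
      have h6 : sz (if f ∈ F then f.swap else f) = sz f := by
        split
        · obtain ⟨x, y⟩ := f
          simp only [sz_pair, Prod.swap]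
          omega
        · rfl
      have := sz_pushStep_le b (if f ∈ F then f.swap else f)
      omega) (t, F)
  have h7 := Nat.mul_le_mul_right (2 * sz L + 1) h2
  have h8 : sz (augment L s t F) ≤
      sz ((searchTree s (residual L F)).foldl pushStep (t, F)) := by
    rw [augment]
    generalize (searchTree s (residual L F)).foldl pushStep (t, F) = p
    obtain ⟨a, b⟩ := p
    simp only [sz_pair]
    omega
  have h9 := sz_pair t F
  omega

end

/-! ### Polynomial-time computability of the flow routines. -/

namespace PT
section
set_option linter.unusedSectionVars false
variable {Γ ν : Type} [Enc Γ] [Enc ν] [DecidableEq ν] [PTEq ν]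

theorem swap {e : Γ → ν × ν} (he : PT e) : PT (fun a => (e a).swap) := pair (snd he) (fst he)

theorem reached {s : Γ → ν} {R : Γ → List (ν × ν)} (hs : PT s) (hR : PT R) :
    PT (fun a => reached (s a) (R a)) :=
  cons hs (map (g := fun _ => Prod.snd) hR (snd (snd id)))

theorem searchStep {s : Γ → ν} {R : Γ → List (ν × ν)} {e : Γ → ν × ν} (hs : PT s) (hR : PT R)
    (he : PT e) : PT (fun a => searchStep (s a) (R a) (e a)) :=
  ite (and (mem (fst he) (reached hs hR)) (not (mem (snd he) (reached hs hR)))) (cons he hR) hR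

theorem foldl_searchStep {s : Γ → ν} {L R : Γ → List (ν × ν)} (hs : PT s) (hL : PT L) (hR : PT R) :
    PT (fun a => (L a).foldl (SepWidth.searchStep (s a)) (R a)) := by
  obtain ⟨p, hp⟩ := hL.size_bound
  refine foldl_grow hL hR (searchStep (hs.comp (fst (fst id))) (snd (fst id)) (snd id))
    ⟨p + 1, fun a b x hx => ?_⟩
  have := sz_searchStep_le (s a) b x
  have := sz_le_of_mem hx
  have := hp a
  simp only [Polynomial.eval_add, Polynomial.eval_one]
  omega

theorem searchTree {s : Γ → ν} {L : Γ → List (ν × ν)} (hs : PT s) (hL : PT L) :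
    PT (fun a => searchTree (s a) (L a)) := by
  obtain ⟨p, hp⟩ := hL.size_bound
  refine foldl_grow (s := fun a R _ => (L a).foldl (SepWidth.searchStep (s a)) R) hL (const [])
    (foldl_searchStep (hs.comp (fst (fst id))) (hL.comp (fst (fst id))) (snd (fst id)))
    ⟨p * (p + 1), fun a b x _ => ?_⟩
  have h1 := sz_foldl_le (f := SepWidth.searchStep (s a)) (l := L a) (c := sz (L a) + 1)
    (fun b x hx => by
      have := sz_searchStep_le (s a) b x
      have := sz_le_of_mem hx
      omega) b
  refine h1.trans ?_
  simp only [Polynomial.eval_add, Polynomial.eval_mul, Polynomial.eval_one]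
  gcongr
  · exact (length_le_sz _).le.trans (hp a)
  · exact hp a

theorem residual {L F : Γ → List (ν × ν)} (hL : PT L) (hF : PT F) :
    PT (fun a => residual (L a) (F a)) :=
  map (g := fun a e => if e ∈ F a then e.swap else e) hL
    (ite (mem (snd id) (hF.comp (fst id))) (swap (snd id)) (snd id))

theorem pushEdge {F : Γ → List (ν × ν)} {e : Γ → ν × ν} (hF : PT F) (he : PT e) :
    PT (fun a => pushEdge (F a) (e a)) :=
  ite (mem (swap he) hF)
    (filter (p := fun a f => f ≠ (e a).swap) hF (not (eq (snd id) (swap (he.comp (fst id))))))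
    (cons he hF)

theorem pushStep {c : Γ → ν × List (ν × ν)} {e : Γ → ν × ν} (hc : PT c) (he : PT e) :
    PT (fun a => pushStep (c a) (e a)) :=
  ite (eq (snd he) (fst hc)) (pair (fst he) (pushEdge (snd hc) he)) hc

theorem augment {L F : Γ → List (ν × ν)} {s t : Γ → ν} (hL : PT L) (hs : PT s) (ht : PT t)
    (hF : PT F) : PT (fun a => augment (L a) (s a) (t a) (F a)) := by
  have hT := searchTree hs (residual hL hF)
  obtain ⟨p, hp⟩ := hT.size_bound
  refine snd (foldl_grow (s := fun _ => SepWidth.pushStep) hT (pair ht hF)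
    (pushStep (snd (fst id)) (snd id)) ⟨2 * p + 1, fun a b x hx => ?_⟩)
  have := sz_pushStep_le b x
  have := sz_le_of_mem hx
  have := hp a
  simp only [Polynomial.eval_add, Polynomial.eval_mul, Polynomial.eval_one, Polynomial.eval_ofNat]
  omega

theorem zip {α β : Type} [Enc α] [Enc β] {l : Γ → List α} {m : Γ → List β} (d : β) (hl : PT l)
    (hm : PT m) : PT (fun a => (l a).zip (m a)) := by
  obtain ⟨p, hp⟩ := hl.size_bound
  -- The second list is consumed inside the accumulator while folding over the first; the default
  -- `d` is never used, since that branch has a nonempty list.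
  let f : List (α × β) × List β → α → List (α × β) × List β :=
    fun q x => if q.2 = [] then q else ((x, q.2.headD d) :: q.1, q.2.tail)
  have key : ∀ (l : List α) (m : List β) (acc : List (α × β)),
      (l.foldl f (acc, m)).1 = (l.zip m).reverse ++ acc := by
    intro l
    induction l with
    | nil => simp
    | cons x l ih =>
      intro m acc
      rw [List.foldl_cons]
      cases m with
      | nil =>
        have := ih [] acc
        simp only [List.zip_nil_right] at this ⊢
        simpa [f] using this
      | cons y m => simpa [f] using ih m ((x, y) :: acc)
  refine (reverse (fst (foldl_grow (s := fun _ => f) hl (pair (const []) hm)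
    (ite (eq_nil (snd (snd (fst id)))) (snd (fst id))
      (pair (cons (pair (snd id) (headD (snd (snd (fst id))) (const d))) (fst (snd (fst id))))
        (tail (snd (snd (fst id)))))) ⟨p + 1, fun a b x hx => ?_⟩))).of_eq fun a => ?_
  · have := sz_le_of_mem hx
    have := hp a
    obtain ⟨b, c⟩ := b
    simp only [Polynomial.eval_add, Polynomial.eval_one, f]
    cases c with
    | nil => simp [sz_pair, sz_nil]
    | cons y c =>
      simp only [reduceCtorEq, if_false, List.headD_cons, List.tail_cons, sz_pair, sz_cons]
      omega
  · simp [key]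

end

/-! ### Polynomial-time computability of one step of the algorithm. -/

section
variable {Γ : Type} [Enc Γ] {N U A B W S X Y w : Γ → List ℕ} {E : Γ → List (ℕ × ℕ)}

theorem network (hE : PT E) (hU : PT U) (hA : PT A) (hB : PT B) :
    PT (fun a => network (E a) (U a) (A a) (B a)) :=
  append (map (g := fun _ a => (((0, 2), (a, 0)) : (ℕ × ℕ) × (ℕ × ℕ))) hA
      (pair (const _) (pair (snd id) (const 0))))
    (append (map (g := fun _ v => (((v, 0), (v, 1)) : (ℕ × ℕ) × (ℕ × ℕ))) hU
        (pair (pair (snd id) (const 0)) (pair (snd id) (const 1))))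
      (append (map (g := fun _ (e : ℕ × ℕ) => (((e.1, 1), (e.2, 0)) : (ℕ × ℕ) × (ℕ × ℕ)))
          (filter (p := fun a (e : ℕ × ℕ) => e.1 ∈ U a ∧ e.2 ∈ U a) hE
            (and (mem (fst (snd id)) (hU.comp (fst id))) (mem (snd (snd id)) (hU.comp (fst id)))))
          (pair (pair (fst (snd id)) (const 1)) (pair (snd (snd id)) (const 0))))
        (map (g := fun _ b => (((b, 1), (0, 3)) : (ℕ × ℕ) × (ℕ × ℕ))) hB
          (pair (pair (snd id) (const 1)) (const _)))))

theorem maxFlow (hE : PT E) (hU : PT U) (hA : PT A) (hB : PT B) :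
    PT (fun a => maxFlow (E a) (U a) (A a) (B a)) := by
  have hN := network hE hU hA hB
  obtain ⟨p, hp⟩ := hN.size_bound
  refine foldl_grow (s := fun a F _ =>
      SepWidth.augment (SepWidth.network (E a) (U a) (A a) (B a)) (0, 2) (0, 3) F) hU (const [])
    (augment (hN.comp (fst (fst id))) (const _) (const _) (snd (fst id)))
    ⟨(sz ((0, 3) : ℕ × ℕ) : Polynomial ℕ) + 1 + p * (2 * p + 1), fun a F x _ => ?_⟩
  refine (sz_augment_le _ _ _ _).trans ?_
  simp only [Polynomial.eval_add, Polynomial.eval_mul, Polynomial.eval_one, Polynomial.eval_ofNat,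
    Polynomial.eval_natCast]
  have := hp a
  gcongr
  simp

theorem sourceSide (hE : PT E) (hU : PT U) (hA : PT A) (hB : PT B) :
    PT (fun a => sourceSide (E a) (U a) (A a) (B a)) :=
  reached (const _) (searchTree (const _) (residual (network hE hU hA hB) (maxFlow hE hU hA hB)))

theorem minCut (hE : PT E) (hU : PT U) (hA : PT A) (hB : PT B) :
    PT (fun a => minCut (E a) (U a) (A a) (B a)) := by
  have hS := sourceSide hE hU hA hB
  exact filter (p := fun a v => v ∈ ((SepWidth.network (E a) (U a) (A a) (B a)).filter fun e =>
      decide (e.1 ∈ SepWidth.sourceSide (E a) (U a) (A a) (B a) ∧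
        e.2 ∉ SepWidth.sourceSide (E a) (U a) (A a) (B a))).map edgeVertex) hU
    (mem (snd id) (PT.comp (g := fun a => ((SepWidth.network (E a) (U a) (A a) (B a)).filter fun e =>
      decide (e.1 ∈ SepWidth.sourceSide (E a) (U a) (A a) (B a) ∧
        e.2 ∉ SepWidth.sourceSide (E a) (U a) (A a) (B a))).map edgeVertex)
      (map (g := fun _ => edgeVertex)
      (filter (p := fun a e => e.1 ∈ SepWidth.sourceSide (E a) (U a) (A a) (B a) ∧
        e.2 ∉ SepWidth.sourceSide (E a) (U a) (A a) (B a)) (network hE hU hA hB)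
        (and (mem (fst (snd id)) (hS.comp (fst id))) (not (mem (snd (snd id)) (hS.comp (fst id))))))
      (ite (eq (snd (fst (snd id))) (const 2)) (fst (snd (snd id))) (fst (fst (snd id)))))
      (fst id)))

theorem cutSide (hE : PT E) (hU : PT U) (hA : PT A) (hB : PT B) :
    PT (fun a => cutSide (E a) (U a) (A a) (B a)) :=
  filter (p := fun a v => v ∉ SepWidth.minCut (E a) (U a) (A a) (B a) ∧
      (v, 1) ∈ SepWidth.sourceSide (E a) (U a) (A a) (B a)) hU
    (and (not (mem (snd id) ((minCut hE hU hA hB).comp (fst id))))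
      (mem (pair (snd id) (const 1)) ((sourceSide hE hU hA hB).comp (fst id))))

theorem boundaryList (hN : PT N) (hE : PT E) (hU : PT U) :
    PT (fun a => boundaryList (N a) (E a) (U a)) :=
  filter (p := fun a u => u ∉ U a ∧ ∃ e ∈ E a, e.1 = u ∧ e.2 ∈ U a) hN
    (and (not (mem (snd id) (hU.comp (fst id))))
      (exists_mem (p := fun (q : Γ × ℕ) (e : ℕ × ℕ) => e.1 = q.2 ∧ e.2 ∈ U q.1) (hE.comp (fst id))
        (and (eq (fst (snd id)) (snd (fst id)))
          (mem (snd (snd id)) (hU.comp (fst (fst id)))))))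

theorem neighbours (hE : PT E) (hU : PT U) (hA : PT A) :
    PT (fun a => neighbours (E a) (U a) (A a)) :=
  filter (p := fun a v => ∃ e ∈ E a, e.1 ∈ A a ∧ e.2 = v) hU
    (exists_mem (p := fun (q : Γ × ℕ) (e : ℕ × ℕ) => e.1 ∈ A q.1 ∧ e.2 = q.2) (hE.comp (fst id))
      (and (mem (fst (snd id)) (hA.comp (fst (fst id)))) (eq (snd (snd id)) (snd (fst id)))))

theorem colourClass (hW : PT W) (hw : PT w) (c : ℕ) :
    PT (fun a => colourClass (W a) (w a) c) :=
  map (g := fun _ => Prod.fst) (filter (p := fun _ (p : ℕ × ℕ) => p.2 = c) (zip 0 hW hw)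
    (eq (snd (snd id)) (const c))) (fst (snd id))

theorem extendWords {T : Γ → List (List ℕ)} (hT : PT T) : PT (fun a => extendWords (T a)) :=
  flatMap (g := fun _ w => [0 :: w, 1 :: w, 2 :: w]) hT
    (cons (cons (const 0) (snd id)) (cons (cons (const 1) (snd id))
      (cons (cons (const 2) (snd id)) (const []))))

theorem trySplit (hE : PT E) (hU : PT U) (hW : PT W) (hw : PT w) :
    PT (fun a => trySplit (E a) (U a) (W a) (w a)) := by
  have h0 := colourClass hW hw 0
  have h1 := colourClass hW hw 1
  have hc := minCut hE hU (neighbours hE hU h0) (neighbours hE hU h1)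
  exact ite (and (not (eq_nil h0)) (and (not (eq_nil h1))
    (and (nat_le (length hc) (length h0)) (nat_le (length hc) (length h1)))))
    (cons (pair hc (cutSide hE hU (neighbours hE hU h0) (neighbours hE hU h1))) (const []))
    (const [])

theorem nodeData {l r : Γ → Data} (hN : PT N) (hU : PT U) (hS : PT S) (hl : PT l) (hr : PT r) :
    PT (fun a => nodeData (N a) (U a) (S a) (l a) (r a)) :=
  data_cons (data_cons
      (toData (map (g := fun a v => decide (v ∈ U a)) hN (mem (snd id) (hU.comp (fst id)))))
      (toData (map (g := fun a v => decide (v ∈ S a)) hN (mem (snd id) (hS.comp (fst id))))))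
    (data_cons hl hr)

theorem splitTasks {rest : Γ → List Task} (hU : PT U) (hS : PT S) (hX : PT X) (hY : PT Y)
    (hr : PT rest) : PT (fun a => splitTasks (U a) (S a) (X a) (Y a) (rest a)) :=
  cons (pair (const false) (pair hX (const []))) (cons (pair (const false) (pair hY (const [])))
    (cons (pair (const true) (pair hU hS)) hr))

theorem solveStep {b : Γ → ℕ} {T : Γ → List (List ℕ)} {todo : Γ → List Task} {done : Γ → List Data}
    (hN : PT N) (hE : PT E) (hb : PT b) (hT : PT T) (ht : PT todo) (hd : PT done) (hU : PT U) :
    PT (fun a => solveStep (N a) (E a) (b a) (T a) (todo a) (done a) (U a)) := by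
  have hW := boundaryList hN hE hU
  have hs := flatMap (g := fun a => SepWidth.trySplit (E a) (U a) (SepWidth.boundaryList (N a) (E a) (U a)))
    hT (trySplit (hE.comp (fst id)) (hU.comp (fst id)) (hW.comp (fst id)) (snd id))
  have hc := headD hs (const (([], []) : List ℕ × List ℕ))
  have hX := fst hc
  have hY := snd hc
  exact ite (eq_nil hU) (pair (pair hN hE) (pair (pair hb hT) (pair (tail ht)
      (cons (const Data.nil) hd))))
    (ite (nat_lt (length hW) hb) (pair (pair hN hE) (pair (pair hb hT)
        (pair (splitTasks hU (cons (headD hU (const 0)) (const [])) (tail hU) (const [])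
          (tail ht)) hd)))
      (ite (eq_nil hs)
        (pair (pair hN hE) (pair (pair (nat_succ (nat_succ (nat_succ hb)))
          (extendWords (extendWords (extendWords hT)))) (pair ht hd)))
        (pair (pair hN hE) (pair (pair hb hT) (pair (splitTasks hU hX hY
          (filter (p := fun a v =>
            v ∉ (((T a).flatMap (SepWidth.trySplit (E a) (U a)
              (SepWidth.boundaryList (N a) (E a) (U a)))).headD ([], [])).1 ∧
            v ∉ (((T a).flatMap (SepWidth.trySplit (E a) (U a)
              (SepWidth.boundaryList (N a) (E a) (U a)))).headD ([], [])).2) hU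
            (and (not (mem (snd id) (hX.comp (fst id)))) (not (mem (snd id) (hY.comp (fst id))))))
          (tail ht)) hd)))))

theorem step : PT step := by
  have hN : PT (fun s : State => s.1.1) := fst (fst id)
  have hE : PT (fun s : State => s.1.2) := snd (fst id)
  have ht : PT (fun s : State => s.2.2.1) := fst (snd (snd id))
  have hd : PT (fun s : State => s.2.2.2) := snd (snd (snd id))
  have hc := headD ht (const ((false, [], []) : Task))
  exact ite (eq_bool_true (fst hc))
    (pair (fst id) (pair (fst (snd id)) (pair (tail ht)
      (cons (nodeData hN (fst (snd hc)) (snd (snd hc)) (headD (tail hd) (const Data.nil))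
        (headD hd (const Data.nil))) (tail (tail hd))))))
    (solveStep hN hE (fst (fst (snd id))) (snd (fst (snd id))) ht hd (fst (snd hc)))

theorem initialState : PT initialState := by
  have hr := range (length (id (α := List (List Bool))))
  have hE : PT edgeList :=
    flatMap (g := fun (M : List (List Bool)) i => ((List.range M.length).filter
      fun j => decide ((M.getD i []).getD j false = true)).map fun j => (i, j)) hr
      (map (g := fun (q : List (List Bool) × ℕ) j => (q.2, j))
        (filter (p := fun (q : List (List Bool) × ℕ) j => (q.1.getD q.2 []).getD j false = true)
          (hr.comp (fst id))
          (eq_bool_true (getD (getD (fst (fst id)) (snd (fst id)) (const [])) (snd id) (const false))))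
        (pair (snd (fst id)) (snd id)))
  exact pair (pair hr hE) (pair (const (0, [[]])) (pair (cons (pair (const false)
    (pair hr (const []))) (const [])) (const [])))

end
end PT
end SepWidth

namespace SepWidth

/-! ### Separator decompositions from tree decompositions -/

section
variable {V : Type*}

theorem IsSeparatorIn.not_adj {G : SimpleGraph V} {R X Y S : Finset V}
    (h : IsSeparatorIn G R X Y S) {u v : V} (hu : u ∈ X) (hv : v ∈ Y) : ¬ G.Adj u v := by
  intro huv
  refine h.separated
    ⟨u, (h.cover u).2 (.inl hu), fun hS => Finset.disjoint_left.1 h.disjoint_left_sep hu hS⟩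
    ⟨v, (h.cover v).2 (.inr (.inl hv)),
      fun hS => Finset.disjoint_left.1 h.disjoint_right_sep hv hS⟩ hu hv ?_
  exact SimpleGraph.Adj.reachable (by simpa using huv)

/-- A walk that avoids `S` can leave `X` only along an edge into `Y`. -/
theorem isSeparatorIn_of_not_adj {G : SimpleGraph V} {R X Y S : Finset V}
    (hc : ∀ v, v ∈ R ↔ v ∈ X ∨ v ∈ Y ∨ v ∈ S) (h1 : Disjoint X Y) (h2 : Disjoint X S)
    (h3 : Disjoint Y S) (h : ∀ u ∈ X, ∀ v ∈ Y, ¬ G.Adj u v) : IsSeparatorIn G R X Y S := by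
  refine ⟨hc, h1, h2, h3, fun u v hu hv ⟨p⟩ => ?_⟩
  induction p with
  | nil => exact Finset.disjoint_left.1 h1 hu hv
  | @cons u w v huw p ih =>
    rcases (hc w.1).1 w.2.1 with hw | hw | hw
    · exact ih hw hv ⟨p⟩
    · exact absurd (by simpa using huw) (h u.1 hu w.1 hw)
    · exact absurd hw w.2.2

theorem TreeDecomposition.exists_walk {G : SimpleGraph V} (D : TreeDecomposition G) {v : V}
    {x y : Fin D.size} (hx : v ∈ D.bag x) (hy : v ∈ D.bag y) :
    ∃ p : D.tree.Walk x y, ∀ z ∈ p.support, v ∈ D.bag z := by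
  obtain ⟨p⟩ := (D.connected v).preconnected ⟨x, hx⟩ ⟨y, hy⟩
  have key : ∀ z ∈ (p.map (SimpleGraph.Embedding.induce _).toHom).support, v ∈ D.bag z := by
    intro z hz
    rw [SimpleGraph.Walk.support_map, List.mem_map] at hz
    obtain ⟨w, -, rfl⟩ := hz
    exact w.2
  exact ⟨_, key⟩

theorem bddBelow_width (G : SimpleGraph V) :
    BddBelow (Set.range fun D : TreeDecomposition G => D.width) :=
  ⟨-1, by rintro _ ⟨D, rfl⟩; simp only [TreeDecomposition.width]; omega⟩

theorem treewidth_le {G : SimpleGraph V} (D : TreeDecomposition G) {b : ℕ}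
    (hb : ∀ i, (D.bag i).card ≤ b) : treewidth G ≤ b - 1 := by
  refine (ciInf_le (bddBelow_width G) D).trans ?_
  have : (Finset.univ.sup fun i => (D.bag i).card) ≤ b := Finset.sup_le fun i _ => hb i
  simp only [TreeDecomposition.width]
  omega

variable [Fintype V]

theorem mem_vertexBoundary {G : SimpleGraph V} {R : Finset V} {u : V} :
    u ∈ vertexBoundary G R ↔ u ∉ R ∧ ∃ v ∈ R, G.Adj u v := by
  simp [vertexBoundary]

open Classical in
/-- All the sets `S_i ∪ ∂V_i` have at most `b` elements. -/
def SepTree.BagsLe (G : SimpleGraph V) (b : ℕ) : SepTree V → Prop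
  | leaf => True
  | node U S l r => (S ∪ vertexBoundary G U).card ≤ b ∧ l.BagsLe G b ∧ r.BagsLe G b

theorem SepTree.BagsLe.width_le {G : SimpleGraph V} {b : ℕ} {t : SepTree V} (h : t.BagsLe G b) :
    t.width G ≤ b := by
  classical
  induction t with
  | leaf => simp [width]
  | node U S l r ihl ihr =>
    simp only [BagsLe] at h
    simp only [width, max_le_iff]
    refine ⟨⟨?_, ?_⟩, ihl h.2.1, ihr h.2.2⟩
    · exact (Finset.card_le_card Finset.subset_union_right).trans (by convert h.1)
    · exact (Finset.card_le_card Finset.subset_union_left).trans (by convert h.1)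

/-- A decomposition of `U`, if the boundary of `U` is contained in a bag. -/
theorem TreeDecomposition.exists_sepTree {G : SimpleGraph V} (D : TreeDecomposition G) {b : ℕ}
    (hb : ∀ i, (D.bag i).card ≤ b) (U : Finset V) (i : Fin D.size)
    (hi : vertexBoundary G U ⊆ D.bag i) :
    ∃ t : SepTree V, t.vertexSet = U ∧ t.Separates G ∧ t.BagsLe G b := by
  classical
  -- Outer induction on the size of `U`; the inner one is on the distance from the current node `i`
  -- to a node `j` whose bag meets `U`.
  induction hn : U.card using Nat.strong_induction_on generalizing U i with
  | _ n ih =>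
  subst hn
  rcases U.eq_empty_or_nonempty with rfl | ⟨v, hv⟩
  · exact ⟨.leaf, rfl, trivial, trivial⟩
  obtain ⟨j, hj⟩ := D.vertex_mem v
  induction hd : D.tree.dist i j using Nat.strong_induction_on generalizing i with
  | _ d ihd =>
  by_cases hne : (U ∩ D.bag i).Nonempty
  · obtain ⟨w, hw⟩ := hne
    rw [Finset.mem_inter] at hw
    obtain ⟨t, ht1, ht2, ht3⟩ := ih (U \ D.bag i).card
      (Finset.card_lt_card ⟨Finset.sdiff_subset, fun h => (Finset.mem_sdiff.1 (h hw.1)).2 hw.2⟩)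
      (U \ D.bag i) i (fun u hu => by
        obtain ⟨h1, x, hx, hux⟩ := mem_vertexBoundary.1 hu
        rw [Finset.mem_sdiff] at h1 hx
        by_cases huU : u ∈ U
        · by_contra h
          exact h1 ⟨huU, h⟩
        · exact hi (mem_vertexBoundary.2 ⟨huU, x, hx.1, hux⟩)) rfl
    refine ⟨.node U (U ∩ D.bag i) t .leaf, rfl, ⟨isSeparatorIn_of_not_adj ?_ ?_ ?_ ?_ ?_, ht2,
      trivial⟩, ?_, ht3, trivial⟩
    · intro x
      rw [ht1]
      simp [SepTree.vertexSet]
      tauto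
    · exact Finset.disjoint_empty_right _
    · rw [ht1, Finset.disjoint_left]
      intro x hx
      simp at hx ⊢
      tauto
    · exact Finset.disjoint_empty_left _
    · simp [SepTree.vertexSet]
    · exact (Finset.card_le_card (Finset.union_subset Finset.inter_subset_right hi)).trans (hb i)
  have hdis : ∀ w ∈ U, w ∉ D.bag i := fun w hw h => hne ⟨w, Finset.mem_inter.2 ⟨hw, h⟩⟩
  -- Now `U` misses the bag at `i`, so all bags of a vertex of `U` lie in one component of the tree
  -- without `i`. `X` collects the vertices in the component of `j`.
  let A : Fin D.size → Fin D.size → Prop := fun x y => ∃ p : D.tree.Walk x y, i ∉ p.support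
  have hA : ∀ w ∈ U, ∀ x y, w ∈ D.bag x → w ∈ D.bag y → A x y := by
    intro w hw x y hx hy
    obtain ⟨p, hp⟩ := D.exists_walk hx hy
    exact ⟨p, fun h => hdis w hw (hp i h)⟩
  have hAt : ∀ x y z, A x y → A y z → A x z := by
    rintro x y z ⟨p, hp⟩ ⟨q, hq⟩
    refine ⟨p.append q, fun h => ?_⟩
    rcases (SimpleGraph.Walk.mem_support_append_iff p q).1 h with h | h
    exacts [hp h, hq h]
  let X := U.filter fun w => ∃ x, w ∈ D.bag x ∧ A j x
  have hX : ∀ w ∈ X, ∀ x, w ∈ D.bag x → A j x := by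
    intro w hw x hx
    obtain ⟨hwU, y, hy, hjy⟩ := Finset.mem_filter.1 hw
    exact hAt _ _ _ hjy (hA w hwU y x hy hx)
  have hvX : v ∈ X := Finset.mem_filter.2 ⟨hv, j, hj, hA v hv j j hj hj⟩
  have hadj : ∀ u ∈ X, ∀ w ∈ U, G.Adj u w → w ∈ X := by
    intro u hu w hw huw
    obtain ⟨m, hm1, hm2⟩ := D.edge_mem u w huw
    exact Finset.mem_filter.2 ⟨hw, m, hm2, hX u hu m hm1⟩
  by_cases hXU : X = U
  -- All of `U` lies beyond the neighbour `i'` of `i` towards `j`. A boundary vertex occurs in the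
  -- bag at `i` and in a bag beyond `i'`; the path between these nodes is unique and passes `i'`, so
  -- the bag at `i'` contains it as well.
  · obtain ⟨p, hp⟩ := D.isTree.connected.exists_walk_length_eq_dist i j
    have hpath := p.isPath_of_length_eq_dist hp
    cases p with
    | nil => exact absurd hj (hdis v hv)
    | @cons _ i' _ hii p =>
      rw [SimpleGraph.Walk.cons_isPath_iff] at hpath
      refine ihd (D.tree.dist i' j) ?_ i' ?_ rfl
      · have := SimpleGraph.dist_le p
        rw [SimpleGraph.Walk.length_cons] at hp
        omega
      intro u hu
      obtain ⟨-, w, hw, huw⟩ := mem_vertexBoundary.1 hu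
      obtain ⟨m, hm1, hm2⟩ := D.edge_mem u w huw
      obtain ⟨q, hq⟩ := hAt _ _ _ ⟨p, hpath.2⟩ (hX w (hXU ▸ hw) m hm2)
      obtain ⟨r, hr⟩ := D.exists_walk (hi hu) hm1
      have hq' : (SimpleGraph.Walk.cons hii q.bypass).IsPath :=
        (SimpleGraph.Walk.cons_isPath_iff ..).2
          ⟨q.bypass_isPath, fun h => hq (q.support_bypass_subset_support h)⟩
      have heq := (D.isTree.existsUnique_path i m).unique hq' r.bypass_isPath
      refine hr i' (r.support_bypass_subset_support ?_)
      rw [← heq]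
      simp
  · have hXs : X ⊂ U := (Finset.filter_subset _ _).ssubset_of_ne hXU
    have hbX : vertexBoundary G X ⊆ vertexBoundary G U := by
      intro u hu
      obtain ⟨h1, x, hx, hux⟩ := mem_vertexBoundary.1 hu
      exact mem_vertexBoundary.2 ⟨fun h => h1 (hadj x hx u h hux.symm), x, hXs.1 hx, hux⟩
    have hbY : vertexBoundary G (U \ X) ⊆ vertexBoundary G U := by
      intro u hu
      obtain ⟨h1, x, hx, hux⟩ := mem_vertexBoundary.1 hu
      rw [Finset.mem_sdiff] at hx h1
      refine mem_vertexBoundary.2 ⟨fun h => ?_, x, hx.1, hux⟩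
      exact hx.2 (hadj u (by_contra fun h' => h1 ⟨h, h'⟩) x hx.1 hux)
    obtain ⟨l, hl1, hl2, hl3⟩ := ih _ (Finset.card_lt_card hXs) X i (hbX.trans hi) rfl
    obtain ⟨r, hr1, hr2, hr3⟩ := ih _ (Finset.card_lt_card
      ⟨Finset.sdiff_subset, fun h => (Finset.mem_sdiff.1 (h hv)).2 hvX⟩) (U \ X) i
      (hbY.trans hi) rfl
    refine ⟨.node U ∅ l r, rfl, ⟨isSeparatorIn_of_not_adj ?_ ?_ ?_ ?_ ?_, hl2, hr2⟩, ?_, hl3, hr3⟩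
    · intro x
      rw [hl1, hr1, Finset.mem_sdiff]
      have := @hXs.1 x
      simp only [Finset.notMem_empty, or_false]
      tauto
    · rw [hl1, hr1]
      exact Finset.disjoint_sdiff
    · exact Finset.disjoint_empty_right _
    · exact Finset.disjoint_empty_right _
    · rw [hl1, hr1]
      intro u hu w hw huw
      rw [Finset.mem_sdiff] at hw
      exact hw.2 (hadj u hu w hw.1 huw)
    · rw [Finset.empty_union]
      exact (Finset.card_le_card hi).trans (hb i)

/-- The tree decomposition with a single bag. -/
def TreeDecomposition.trivial (G : SimpleGraph V) : TreeDecomposition G where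
  size := 1
  tree := ⊥
  isTree := .of_subsingleton
  bag _ := Finset.univ
  vertex_mem v := ⟨0, Finset.mem_univ v⟩
  edge_mem u v _ := ⟨0, Finset.mem_univ u, Finset.mem_univ v⟩
  connected v := by
    have : Nonempty ↑{i : Fin 1 | v ∈ (Finset.univ : Finset V)} := ⟨⟨0, Finset.mem_univ v⟩⟩
    exact SimpleGraph.IsTree.of_subsingleton.connected

theorem exists_bag_card_le (G : SimpleGraph V) :
    ∃ D : TreeDecomposition G, ∀ i, ((D.bag i).card : ℤ) ≤ treewidth G + 1 := by
  have : Nonempty (TreeDecomposition G) := ⟨.trivial G⟩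
  obtain ⟨D, hD⟩ := Int.csInf_mem (Set.range_nonempty _) (bddBelow_width G)
  refine ⟨D, fun i => ?_⟩
  have h1 : (D.bag i).card ≤ (Finset.univ.sup fun i => (D.bag i).card) :=
    Finset.le_sup (f := fun i => (D.bag i).card) (Finset.mem_univ i)
  have h2 : D.width = treewidth G := hD
  rw [← h2, TreeDecomposition.width]
  omega

theorem neg_one_le_treewidth (G : SimpleGraph V) : -1 ≤ treewidth G := by
  have : Nonempty (TreeDecomposition G) := ⟨.trivial G⟩
  exact le_ciInf fun D => by simp only [TreeDecomposition.width]; omega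

/-- The treewidth is witnessed by a separator decomposition. -/
theorem exists_bagsLe (G : SimpleGraph V) :
    ∃ t : SepTree V, t.IsDecomposition G ∧ t.BagsLe G (treewidth G + 1).toNat := by
  obtain ⟨D, hD⟩ := exists_bag_card_le G
  have : Nonempty (Fin D.size) := D.isTree.connected.nonempty
  obtain ⟨t, h1, h2, h3⟩ := D.exists_sepTree (b := (treewidth G + 1).toNat)
    (fun i => by have := hD i; omega) Finset.univ (Classical.arbitrary _) fun u hu =>
      absurd (Finset.mem_univ u) (mem_vertexBoundary.1 hu).1
  exact ⟨t, ⟨h1, h2⟩, h3⟩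

theorem separatorWidth_le_treewidth (G : SimpleGraph V) :
    (separatorWidth G : ℤ) ≤ treewidth G + 1 := by
  obtain ⟨t, h1, h2⟩ := exists_bagsLe G
  have h3 : separatorWidth G ≤ t.width G := Nat.sInf_le ⟨t, h1, rfl⟩
  have := h2.width_le
  have := neg_one_le_treewidth G
  omega

/-! ### Balanced separators -/

open Classical in
-- Descend to a child while it contains more than half of `W`; leaves are empty, so this stops.
-- There `S ∪ ∂U` (colour 3) separates the two children (0 and 1) and the outside of `U` (2), and
-- none of these three holds more than half of `W`: the children because the descent stopped, the
-- outside because `U` holds more than half.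
theorem SepTree.exists_balanced {G : SimpleGraph V} {b : ℕ} (W : Finset V) (t : SepTree V)
    (hs : t.Separates G) (hb : t.BagsLe G b) (hW : W.card < 2 * (W ∩ t.vertexSet).card) :
    ∃ f : V → Fin 4, (Finset.univ.filter fun v => f v = 3).card ≤ b ∧
      (∀ u v, G.Adj u v → f u = f v ∨ f u = 3 ∨ f v = 3) ∧
      ∀ c, c ≠ 3 → 2 * (W.filter fun v => f v = c).card ≤ W.card := by
  induction t with
  | leaf => simp [vertexSet] at hW
  | node U S l r ihl ihr =>
    by_cases hl : W.card < 2 * (W ∩ l.vertexSet).card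
    · exact ihl hs.2.1 hb.2.1 hl
    by_cases hr : W.card < 2 * (W ∩ r.vertexSet).card
    · exact ihr hs.2.2 hb.2.2 hr
    have hsep := hs.1
    refine ⟨fun v => if v ∈ S ∪ vertexBoundary G U then 3 else if v ∈ l.vertexSet then 0
      else if v ∈ r.vertexSet then 1 else 2, ?_, ?_, ?_⟩
    · refine (Finset.card_le_card fun v hv => ?_).trans hb.1
      by_contra h
      have := (Finset.mem_filter.1 hv).2
      simp only [h, if_false] at this
      split_ifs at this <;> exact absurd this (by decide)
    · intro u v huv
      by_cases hu : u ∈ S ∪ vertexBoundary G U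
      · simp [hu]
      by_cases hv : v ∈ S ∪ vertexBoundary G U
      · simp [hv]
      left
      simp only [hu, hv, if_false]
      rw [Finset.mem_union, not_or, mem_vertexBoundary] at hu hv
      have hUU : u ∈ U ↔ v ∈ U := by
        constructor
        · intro h
          by_contra h'
          exact hv.2 ⟨h', u, h, huv.symm⟩
        · intro h
          by_contra h'
          exact hu.2 ⟨h', v, h, huv⟩
      have hlr : ∀ x y, G.Adj x y → x ∈ U → y ∈ U → x ∉ S → y ∉ S →
          (x ∈ l.vertexSet → y ∈ l.vertexSet) ∧ (x ∈ r.vertexSet → y ∈ r.vertexSet) := by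
        intro x y hxy hx hy hxS hyS
        rcases (hsep.cover y).1 hy with h | h | h
        · exact ⟨fun _ => h, fun h' => absurd hxy.symm (hsep.not_adj h h')⟩
        · exact ⟨fun h' => absurd hxy (hsep.not_adj h' h), fun _ => h⟩
        · exact absurd h hyS
      by_cases huU : u ∈ U
      · have h1 := hlr u v huv huU (hUU.1 huU) hu.1 hv.1
        have h2 := hlr v u huv.symm (hUU.1 huU) huU hv.1 hu.1
        rw [if_congr ⟨h1.1, h2.1⟩ rfl (if_congr ⟨h1.2, h2.2⟩ rfl rfl)]
      · have hout : ∀ x, x ∉ U → x ∉ l.vertexSet ∧ x ∉ r.vertexSet := fun x hx =>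
          ⟨fun h => hx ((hsep.cover x).2 (.inl h)), fun h => hx ((hsep.cover x).2 (.inr (.inl h)))⟩
        have h1 := hout u huU
        have h2 := hout v fun h => huU (hUU.2 h)
        simp only [h1.1, h1.2, h2.1, h2.2, if_false]
    · intro c hc
      have hle : ∀ T : Finset V, 2 * (W ∩ T).card ≤ W.card →
          (∀ v ∈ W, (if v ∈ S ∪ vertexBoundary G U then 3 else if v ∈ l.vertexSet then 0
            else if v ∈ r.vertexSet then 1 else 2 : Fin 4) = c → v ∈ T) →
          2 * (W.filter fun v => (if v ∈ S ∪ vertexBoundary G U then 3 else if v ∈ l.vertexSet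
            then 0 else if v ∈ r.vertexSet then 1 else 2 : Fin 4) = c).card ≤ W.card := by
        intro T hT h
        refine le_trans (Nat.mul_le_mul_left 2 (Finset.card_le_card fun v hv => ?_)) hT
        rw [Finset.mem_filter] at hv
        exact Finset.mem_inter.2 ⟨hv.1, h v hv.1 hv.2⟩
      have hc' : c = 0 ∨ c = 1 ∨ c = 2 := by
        clear hle
        revert c; decide
      rcases hc' with rfl | rfl | rfl
      · refine hle l.vertexSet (by omega) fun v _ h => ?_
        split_ifs at h <;> first | assumption | (exfalso; revert h; decide)
      · refine hle r.vertexSet (by omega) fun v _ h => ?_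
        split_ifs at h <;> first | assumption | (exfalso; revert h; decide)
      · refine hle Uᶜ ?_ fun v _ h => ?_
        · have h1 := Finset.card_inter_add_card_sdiff W U
          have h2 : W ∩ Uᶜ = W \ U := by ext; simp
          simp only [vertexSet] at hW
          rw [h2]
          omega
        · have hc := hsep.cover v
          split_ifs at h
          all_goals first | (exfalso; revert h; decide) | skip
          simp_all

theorem treewidth_nonneg [Nonempty V] (G : SimpleGraph V) : 0 ≤ treewidth G := by
  obtain ⟨D, hD⟩ := exists_bag_card_le G
  obtain ⟨i, hi⟩ := D.vertex_mem (Classical.arbitrary V)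
  have := Finset.card_pos.2 ⟨_, hi⟩
  have := hD i
  omega

/-- A balanced separator for a set of `3b` vertices in a graph of treewidth less than `b`. -/
theorem exists_balanced_separator [DecidableEq V] {G : SimpleGraph V} {b : ℕ}
    (hb : treewidth G < b) (hb0 : 0 < b)
    {W : Finset V} (hW : W.card = 3 * b) :
    ∃ P S : Finset V, Disjoint P S ∧ S.card ≤ b ∧ (∀ u ∈ P, ∀ v, G.Adj u v → v ∈ P ∨ v ∈ S) ∧
      (W ∩ P).card ≤ 2 * b ∧ (W \ (P ∪ S)).card ≤ 2 * b ∧ (W ∩ P).Nonempty ∧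
      (W \ (P ∪ S)).Nonempty := by
  obtain ⟨t, ⟨h1, h2⟩, h3⟩ := exists_bagsLe G
  obtain ⟨f, hf1, hf2, hf3⟩ := t.exists_balanced W h2 h3 (by
    rw [h1]; simp only [Finset.inter_univ]; omega)
  have hsum := Finset.card_eq_sum_card_fiberwise (f := f) (s := W) (t := Finset.univ)
    fun _ _ => Finset.mem_coe.2 (Finset.mem_univ _)
  rw [Fin.sum_univ_four] at hsum
  have h0 := hf3 0 (by decide)
  have h1 := hf3 1 (by decide)
  have h2 := hf3 2 (by decide)
  have hS : (W.filter fun v => f v = 3).card ≤ b :=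
    (Finset.card_le_card (Finset.filter_subset_filter _ (Finset.subset_univ _))).trans
      (hf1.trans (by omega))
  -- Take the largest of the three classes. Together with the separator it contains at least a third
  -- of `W`, so at most `2 * b` elements remain for the other two.
  obtain ⟨c, hc3, hc⟩ : ∃ c : Fin 4, c ≠ 3 ∧ 2 * (W.filter fun v => f v = c).card ≤ W.card ∧
      0 < (W.filter fun v => f v = c).card ∧
      W.card ≤ (W.filter fun v => f v = 3).card + (W.filter fun v => f v = c).card + 2 * b := by
    rcases le_total (W.filter fun v => f v = 0).card (W.filter fun v => f v = 1).card with h | h <;>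
    rcases le_total (W.filter fun v => f v = 0).card (W.filter fun v => f v = 2).card with h' | h' <;>
    rcases le_total (W.filter fun v => f v = 1).card (W.filter fun v => f v = 2).card with h'' | h''
    all_goals first
      | exact ⟨0, by decide, by omega, by omega, by omega⟩
      | exact ⟨1, by decide, by omega, by omega, by omega⟩
      | exact ⟨2, by decide, by omega, by omega, by omega⟩
  have hP : W ∩ (Finset.univ.filter fun v => f v = c) = W.filter fun v => f v = c := by
    ext; simp
  have hR : (W \ ((Finset.univ.filter fun v => f v = c) ∪
      Finset.univ.filter fun v => f v = 3)).card + (W.filter fun v => f v = c).card +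
      (W.filter fun v => f v = 3).card = W.card := by
    have e1 : W ∩ ((Finset.univ.filter fun v => f v = c) ∪ Finset.univ.filter fun v => f v = 3) =
        (W.filter fun v => f v = c) ∪ W.filter fun v => f v = 3 := by
      ext; simp; tauto
    have e2 : Disjoint (W.filter fun v => f v = c) (W.filter fun v => f v = 3) := by
      rw [Finset.disjoint_filter]
      intro x _ h h'
      exact hc3 (h.symm.trans h')
    have e3 := Finset.card_inter_add_card_sdiff W
      ((Finset.univ.filter fun v => f v = c) ∪ Finset.univ.filter fun v => f v = 3)
    rw [e1, Finset.card_union_of_disjoint e2] at e3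
    omega
  refine ⟨Finset.univ.filter fun v => f v = c, Finset.univ.filter fun v => f v = 3, ?_,
    hf1.trans (by omega), ?_, ?_, ?_, ?_, ?_⟩
  · rw [Finset.disjoint_filter]
    intro x _ h h'
    exact hc3 (h.symm.trans h')
  · intro u hu v huv
    simp only [Finset.mem_filter, Finset.mem_univ, true_and] at hu ⊢
    rcases hf2 u v huv with h | h | h
    · exact .inl (h ▸ hu)
    · exact absurd (hu.symm.trans h) hc3
    · exact .inr h
  · rw [hP]; omega
  · omega
  · rw [hP, ← Finset.card_pos]; omega
  · rw [← Finset.card_pos]; omega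

end
end SepWidth

namespace SepWidth

/-! ### Tree decompositions from separator decompositions -/

theorem connected_image {α β : Type*} {T : SimpleGraph α} {T' : SimpleGraph β} {s : Set α}
    (f : α → β) (hf : ∀ a b, T.Adj a b → T'.Adj (f a) (f b)) (h : (T.induce s).Connected) :
    (T'.induce (f '' s)).Connected := by
  let φ : T.induce s →g T'.induce (f '' s) :=
    ⟨fun a => ⟨f a, a.1, a.2, rfl⟩, fun {a b} hab => hf _ _ hab⟩
  refine h.map φ ?_
  rintro ⟨_, a, ha, rfl⟩
  exact ⟨⟨a, ha⟩, rfl⟩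

/-- The graph `T` with a leaf attached to the vertex `i`. -/
def addLeaf {m : ℕ} (T : SimpleGraph (Fin m)) (i : Fin m) : SimpleGraph (Fin (m + 1)) :=
  T.map Fin.castSuccEmb ⊔ SimpleGraph.edge i.castSucc (Fin.last m)

section
variable {m : ℕ} {T : SimpleGraph (Fin m)} {i : Fin m}

theorem addLeaf_adj {a b : Fin m} (h : T.Adj a b) : (addLeaf T i).Adj a.castSucc b.castSucc :=
  .inl ((SimpleGraph.map_adj ..).2 ⟨a, b, h, rfl, rfl⟩)

theorem addLeaf_adj_last : (addLeaf T i).Adj i.castSucc (Fin.last m) :=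
  .inr ((SimpleGraph.edge_adj ..).2 ⟨.inl ⟨rfl, rfl⟩, Fin.castSucc_ne_last i⟩)

theorem addLeaf_induce_connected {s : Set (Fin m)} (h : (T.induce s).Connected) (hi : i ∈ s) :
    ((addLeaf T i).induce (Fin.castSucc '' s ∪ {i.castSucc, Fin.last m})).Connected := by
  have h1 := connected_image (T' := addLeaf T i) Fin.castSucc (fun _ _ => addLeaf_adj) h
  have h2 := SimpleGraph.induce_pair_connected_of_adj (addLeaf_adj_last (T := T) (i := i))
  refine SimpleGraph.induce_union_connected h1.preconnected h2.preconnected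
    ⟨i.castSucc, ⟨i, hi, rfl⟩, .inl rfl⟩

/-- By counting: the graph stays connected and gains one vertex and one edge. -/
theorem isTree_addLeaf (hT : T.IsTree) : (addLeaf T i).IsTree := by
  rw [SimpleGraph.isTree_iff_connected_and_card] at hT ⊢
  constructor
  · have h := addLeaf_induce_connected (i := i)
      ((SimpleGraph.induceUnivIso T).connected_iff.2 hT.1) (Set.mem_univ i)
    have hu : Fin.castSucc '' Set.univ ∪ {i.castSucc, Fin.last m} = Set.univ := by
      ext x
      cases x using Fin.lastCases <;> simp
    rw [hu] at h
    exact (SimpleGraph.induceUnivIso _).connected_iff.1 h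
  · have h1 : (addLeaf T i).edgeSet =
        insert s(i.castSucc, Fin.last m) (Sym2.map Fin.castSuccEmb '' T.edgeSet) := by
      rw [addLeaf, SimpleGraph.edgeSet_sup, SimpleGraph.edgeSet_edge_of_ne (Fin.castSucc_ne_last i),
        SimpleGraph.edgeSet_map, Set.union_comm]
      rfl
    have h2 : s(i.castSucc, Fin.last m) ∉ Sym2.map Fin.castSuccEmb '' T.edgeSet := by
      rintro ⟨e, -, he⟩
      have : Fin.last m ∈ Sym2.map Fin.castSuccEmb e := he ▸ Sym2.mem_mk_right _ _
      obtain ⟨a, -, ha⟩ := Sym2.mem_map.1 this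
      exact Fin.castSucc_ne_last a ha
    rw [h1, Nat.card_coe_set_eq, Set.ncard_insert_of_notMem h2 (Set.toFinite _),
      Set.ncard_image_of_injective _ (Sym2.map.injective (Fin.castSuccEmb).injective),
      ← Nat.card_coe_set_eq, hT.2]
    simp
end

/-- A tree decomposition of the part of `G` that is induced by `R`. -/
structure IsPartialDecomposition {V : Type*} (G : SimpleGraph V) (b : ℕ) (R : Finset V) {m : ℕ}
    (T : SimpleGraph (Fin m)) (bag : Fin m → Finset V) : Prop where
  isTree : T.IsTree
  card_le : ∀ i, (bag i).card ≤ b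
  subset : ∀ i, bag i ⊆ R
  edge_mem : ∀ u ∈ R, ∀ v ∈ R, G.Adj u v → ∃ i, u ∈ bag i ∧ v ∈ bag i
  connected : ∀ v ∈ R, (T.induce {i | v ∈ bag i}).Connected

section
variable {V : Type*}

open Classical in
-- `hRB` keeps the bags of each old vertex connected through `i`; `hadj` puts every edge between an
-- old and a new vertex into the new bag.
theorem IsPartialDecomposition.addLeaf {G : SimpleGraph V} {b : ℕ} {R B : Finset V} {m : ℕ}
    {T : SimpleGraph (Fin m)} {bag : Fin m → Finset V} (h : IsPartialDecomposition G b R T bag)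
    {i : Fin m} (hB : B.card ≤ b) (hRB : R ∩ B ⊆ bag i)
    (hadj : ∀ u ∈ R, ∀ v ∈ B, v ∉ R → G.Adj u v → u ∈ B) :
    IsPartialDecomposition G b (R ∪ B) (addLeaf T i)
      (Fin.snoc (α := fun _ => Finset V) bag B) := by
  refine ⟨isTree_addLeaf h.isTree, fun j => ?_, fun j => ?_, fun u hu v hv huv => ?_,
    fun v hv => ?_⟩
  · cases j using Fin.lastCases
    · simpa using hB
    · simpa using h.card_le _
  · cases j using Fin.lastCases
    · simp
    · simpa using (h.subset _).trans Finset.subset_union_left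
  · have hBB : u ∈ B → v ∈ B → ∃ i, u ∈ Fin.snoc (α := fun _ => Finset V) bag B i ∧
        v ∈ Fin.snoc (α := fun _ => Finset V) bag B i := fun h1 h2 =>
      ⟨Fin.last m, by simpa using h1, by simpa using h2⟩
    rw [Finset.mem_union] at hu hv
    by_cases huR : u ∈ R
    · by_cases hvR : v ∈ R
      · obtain ⟨j, h1, h2⟩ := h.edge_mem u huR v hvR huv
        exact ⟨j.castSucc, by simpa using h1, by simpa using h2⟩
      · have hvB := hv.resolve_left hvR
        exact hBB (hadj u huR v hvB hvR huv) hvB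
    · have huB := hu.resolve_left huR
      by_cases hvR : v ∈ R
      · exact hBB huB (hadj v hvR u huB huR huv.symm)
      · exact hBB huB (hv.resolve_left hvR)
  · by_cases hvB : v ∈ B
    · by_cases hvR : v ∈ R
      · have hi : v ∈ bag i := hRB (Finset.mem_inter.2 ⟨hvR, hvB⟩)
        have hs : {j | v ∈ Fin.snoc (α := fun _ => Finset V) bag B j} =
            Fin.castSucc '' {j | v ∈ bag j} ∪ {i.castSucc, Fin.last m} := ?_
        · rw [hs]
          exact addLeaf_induce_connected (h.connected v hvR) hi
        ext x
        cases x using Fin.lastCases with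
        | last => simp [hvB]
        | cast x =>
          simp only [Set.mem_ofPred_eq, Fin.snoc_castSucc, Set.mem_union, Set.mem_image,
            Fin.castSucc_inj, exists_eq_right, Set.mem_insert_iff, Set.mem_singleton_iff,
            Fin.castSucc_ne_last, or_false]
          exact ⟨.inl, fun h => h.elim id fun h => h ▸ hi⟩
      · have : {j | v ∈ Fin.snoc (α := fun _ => Finset V) bag B j} = {Fin.last m} := by
          ext x
          cases x using Fin.lastCases with
          | last => simp [hvB]
          | cast x =>
            simp only [Set.mem_ofPred_eq, Fin.snoc_castSucc, Set.mem_singleton_iff,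
              Fin.castSucc_ne_last, iff_false]
            exact fun h' => hvR (h.subset x h')
        rw [this, SimpleGraph.induce_singleton_eq_top]
        exact SimpleGraph.connected_top
    · have hvR := (Finset.mem_union.1 hv).resolve_right hvB
      have hs : {j | v ∈ Fin.snoc (α := fun _ => Finset V) bag B j} =
          Fin.castSucc '' {j | v ∈ bag j} := ?_
      · rw [hs]
        exact connected_image _ (fun _ _ => addLeaf_adj) (h.connected v hvR)
      ext x
      cases x using Fin.lastCases <;> simp [hvB]

variable [Fintype V]

open Classical in
/-- A partial tree decomposition is extended by a separator decomposition of a further set whose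
boundary is contained in a bag. -/
theorem IsPartialDecomposition.extend {G : SimpleGraph V} {w : ℕ} (t : SepTree V)
    (ht : t.Separates G) (hw : t.width G ≤ w) : ∀ (R : Finset V) (m : ℕ) (T : SimpleGraph (Fin m))
    (bag : Fin m → Finset V), IsPartialDecomposition G (2 * w) R T bag →
    ∀ i, Disjoint R t.vertexSet → vertexBoundary G t.vertexSet ⊆ bag i →
    ∃ (m' : ℕ) (T' : SimpleGraph (Fin m')) (bag' : Fin m' → Finset V),
      IsPartialDecomposition G (2 * w) (R ∪ t.vertexSet) T' bag' ∧ ∀ j, ∃ j', bag' j' = bag j := by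
  induction t with
  | leaf =>
    intro R m T bag h i _ _
    exact ⟨m, T, bag, by simpa [SepTree.vertexSet] using h, fun j => ⟨j, rfl⟩⟩
  | node U S l r ihl ihr =>
    intro R m T bag h i hR hi
    have hsep := ht.1
    simp only [SepTree.width, max_le_iff] at hw
    simp only [SepTree.vertexSet] at hR hi ⊢
    have hmem : ∀ {x}, x ∈ U ↔ x ∈ l.vertexSet ∨ x ∈ r.vertexSet ∨ x ∈ S := fun {x} => hsep.cover x
    have hRU : ∀ x ∈ R, x ∉ U := fun x h1 h2 => Finset.disjoint_left.1 hR h1 h2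
    have hl : ∀ x ∈ vertexBoundary G l.vertexSet, x ∈ S ∪ vertexBoundary G U := by
      intro x hx
      obtain ⟨h1, y, hy, hxy⟩ := mem_vertexBoundary.1 hx
      rw [Finset.mem_union, mem_vertexBoundary]
      by_cases hxU : x ∈ U
      · rcases hmem.1 hxU with h | h | h
        · exact absurd h h1
        · exact absurd hxy.symm (hsep.not_adj hy h)
        · exact .inl h
      · exact .inr ⟨hxU, y, hmem.2 (.inl hy), hxy⟩
    have hr : ∀ x ∈ vertexBoundary G r.vertexSet, x ∈ S ∪ vertexBoundary G U := by
      intro x hx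
      obtain ⟨h1, y, hy, hxy⟩ := mem_vertexBoundary.1 hx
      rw [Finset.mem_union, mem_vertexBoundary]
      by_cases hxU : x ∈ U
      · rcases hmem.1 hxU with h | h | h
        · exact absurd hxy (hsep.not_adj h hy)
        · exact absurd h h1
        · exact .inl h
      · exact .inr ⟨hxU, y, hmem.2 (.inr (.inl hy)), hxy⟩
    -- The new bag has at most `2 * w` elements, `w` from each part. A neighbour in `R` of a vertex
    -- of `S` belongs to the boundary of `U`, so the new edges are covered.
    have h1 := h.addLeaf (i := i) (B := S ∪ vertexBoundary G U)
      ((Finset.card_union_le _ _).trans (by have := hw.1; omega))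
      (fun x hx => by
        rw [Finset.mem_inter, Finset.mem_union] at hx
        rcases hx.2 with h | h
        · exact absurd (hmem.2 (.inr (.inr h))) (hRU x hx.1)
        · exact hi h)
      (fun u hu v hv hvR huv => by
        rw [Finset.mem_union] at hv ⊢
        rcases hv with h' | h'
        · exact .inr (mem_vertexBoundary.2 ⟨hRU u hu, v, hmem.2 (.inr (.inr h')), huv⟩)
        · exact absurd (h.subset i (hi h')) hvR)
    have hR1 : ∀ x, x ∈ R ∪ (S ∪ vertexBoundary G U) ↔ x ∈ R ∨ x ∈ S := by
      intro x
      simp only [Finset.mem_union]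
      exact ⟨fun h' => h'.elim .inl fun h' => h'.elim .inr fun h' => .inl (h.subset i (hi h')),
        fun h' => h'.elim .inl fun h' => .inr (.inl h')⟩
    obtain ⟨m₂, T₂, bag₂, h2, hb2⟩ := ihl ht.2.1 hw.2.1 _ _ _ _ h1 (Fin.last m) (by
      rw [Finset.disjoint_left]
      intro x hx hxl
      rcases (hR1 x).1 hx with h' | h'
      · exact hRU x h' (hmem.2 (.inl hxl))
      · exact Finset.disjoint_left.1 hsep.disjoint_left_sep hxl h') (by
      rw [Fin.snoc_last]
      exact hl)
    -- The bag of this node survives the treatment of the left subtree, so the right subtree can be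
    -- attached to it too. This is why old bags are tracked in the conclusion.
    obtain ⟨j, hj⟩ := hb2 (Fin.last m)
    obtain ⟨m₃, T₃, bag₃, h3, hb3⟩ := ihr ht.2.2 hw.2.2 _ _ _ _ h2 j (by
      rw [Finset.disjoint_left]
      intro x hx hxr
      rcases Finset.mem_union.1 hx with h' | h'
      · rcases (hR1 x).1 h' with h' | h'
        · exact hRU x h' (hmem.2 (.inr (.inl hxr)))
        · exact Finset.disjoint_left.1 hsep.disjoint_right_sep hxr h'
      · exact Finset.disjoint_left.1 hsep.disjoint_left_right h' hxr) (by
      rw [hj, Fin.snoc_last]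
      exact hr)
    refine ⟨m₃, T₃, bag₃, ?_, fun k => ?_⟩
    · convert h3 using 1
      ext x
      rw [Finset.mem_union, Finset.mem_union, Finset.mem_union, hR1, hmem]
      tauto
    · obtain ⟨k₂, hk₂⟩ := hb2 k.castSucc
      obtain ⟨k₃, hk₃⟩ := hb3 k₂
      exact ⟨k₃, by rw [hk₃, hk₂, Fin.snoc_castSucc]⟩

theorem treewidth_add_one_le {G : SimpleGraph V} {t : SepTree V} (ht : t.IsDecomposition G) :
    treewidth G + 1 ≤ 2 * t.width G := by
  classical
  -- Start from a single empty bag, which contains the boundary of the whole vertex set.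
  have h0 : IsPartialDecomposition G (2 * t.width G) ∅ (⊥ : SimpleGraph (Fin 1)) fun _ => ∅ :=
    ⟨.of_subsingleton, by simp, by simp, by simp, by simp⟩
  obtain ⟨m, T, bag, h, -⟩ := IsPartialDecomposition.extend t ht.2 le_rfl _ _ _ _ h0 0 (by simp)
    fun u hu => absurd (ht.1 ▸ Finset.mem_univ u) (mem_vertexBoundary.1 hu).1
  rw [ht.1, Finset.empty_union] at h
  let D : TreeDecomposition G :=
    { size := m, tree := T, isTree := h.isTree, bag := bag
      vertex_mem := fun v => (h.connected v (Finset.mem_univ v)).nonempty.elim fun i => ⟨i.1, i.2⟩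
      edge_mem := fun u v => h.edge_mem u (Finset.mem_univ u) v (Finset.mem_univ v)
      connected := fun v => h.connected v (Finset.mem_univ v) }
  have := treewidth_le D h.card_le
  push_cast at this
  omega

theorem treewidth_add_one_le_separatorWidth (G : SimpleGraph V) :
    treewidth G + 1 ≤ 2 * separatorWidth G := by
  obtain ⟨t₀, ht₀, -⟩ := exists_bagsLe G
  obtain ⟨t, ht, h⟩ := Nat.sInf_mem (s := {w | ∃ t : SepTree V, t.IsDecomposition G ∧ t.width G = w})
    ⟨_, t₀, ht₀, rfl⟩
  have := treewidth_add_one_le ht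
  rwa [h] at this

end
end SepWidth

namespace SepWidth
open Enc

/-! ### Lists of numbers as sets of vertices -/

/-- The set of vertices listed in `U`. -/
def vset (n : ℕ) (U : List ℕ) : Finset (Fin n) := Finset.univ.filter fun i => i.val ∈ U

/-- `U` lists vertices without repetitions. -/
def IsVertexList (n : ℕ) (U : List ℕ) : Prop := U.Nodup ∧ ∀ x ∈ U, x < n

/-- `E` lists the edges of `G`, each in both directions. -/
def IsEdgeList {n : ℕ} (G : SimpleGraph (Fin n)) (E : List (ℕ × ℕ)) : Prop :=
  ∀ i j : ℕ, (i, j) ∈ E ↔ ∃ (hi : i < n) (hj : j < n), G.Adj ⟨i, hi⟩ ⟨j, hj⟩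

section
variable {n : ℕ} {G : SimpleGraph (Fin n)} {E : List (ℕ × ℕ)} {U S X Y W : List ℕ}

theorem mem_vset {i : Fin n} : i ∈ vset n U ↔ i.val ∈ U := by simp [vset]

theorem IsEdgeList.mem_iff (hE : IsEdgeList G E) {u v : Fin n} : (u.val, v.val) ∈ E ↔ G.Adj u v := by
  rw [hE]
  simp

theorem IsVertexList.card_vset (hU : IsVertexList n U) : (vset n U).card = U.length := by
  rw [← List.toFinset_card_of_nodup hU.1, ← Finset.card_map Fin.valEmbedding]
  congr 1
  ext x
  simp only [Finset.mem_map, mem_vset, Fin.valEmbedding_apply, List.mem_toFinset]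
  exact ⟨by rintro ⟨i, hi, rfl⟩; exact hi, fun h => ⟨⟨x, hU.2 x h⟩, h, rfl⟩⟩

theorem IsVertexList.sublist (hU : IsVertexList n U) (h : X.Sublist U) : IsVertexList n X :=
  ⟨hU.1.sublist h, fun x hx => hU.2 x (h.subset hx)⟩

theorem IsVertexList.filter (hU : IsVertexList n U) (p : ℕ → Bool) :
    IsVertexList n (U.filter p) := hU.sublist List.filter_sublist

theorem isVertexList_nil : IsVertexList n [] := ⟨by simp, by simp⟩

theorem isVertexList_range : IsVertexList n (List.range n) :=
  ⟨List.nodup_range, fun _ hx => List.mem_range.1 hx⟩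

theorem IsVertexList.length_le (hU : IsVertexList n U) : U.length ≤ n := by
  rw [← hU.card_vset]
  simpa using Finset.card_le_univ (vset n U)

theorem IsVertexList.sz_le (hU : IsVertexList n U) : sz U ≤ n * (2 * n + 1) + 1 := by
  refine (sz_le_of_forall (K := 2 * n) fun x hx => ?_).trans ?_
  · have := hU.2 x hx
    rw [sz_nat]
    omega
  · have := hU.length_le
    gcongr

theorem isVertexList_boundaryList : IsVertexList n (boundaryList (List.range n) E U) :=
  isVertexList_range.filter _

theorem vset_boundaryList (hE : IsEdgeList G E) :
    vset n (boundaryList (List.range n) E U) = vertexBoundary G (vset n U) := by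
  ext u
  simp only [mem_vset, mem_vertexBoundary, boundaryList, List.mem_filter, List.mem_range, u.2,
    true_and, decide_eq_true_eq, Prod.exists]
  refine and_congr_right fun _ => ⟨?_, ?_⟩
  · rintro ⟨a, b, hab, rfl, hb⟩
    obtain ⟨_, hj, h⟩ := (hE _ _).1 hab
    exact ⟨⟨b, hj⟩, hb, h⟩
  · rintro ⟨v, hv, h⟩
    exact ⟨u, v, hE.mem_iff.2 h, rfl, hv⟩

theorem mem_neighbours {A : List ℕ} {v : ℕ} :
    v ∈ neighbours E U A ↔ v ∈ U ∧ ∃ a ∈ A, (a, v) ∈ E := by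
  simp only [neighbours, List.mem_filter, decide_eq_true_eq, Prod.exists]
  refine and_congr_right fun _ => ⟨?_, ?_⟩
  · rintro ⟨a, b, h, ha, rfl⟩
    exact ⟨a, ha, h⟩
  · rintro ⟨a, ha, h⟩
    exact ⟨a, v, h, ha, rfl⟩

theorem map_fst_zip_sublist {α β : Type*} (l : List α) (m : List β) :
    ((l.zip m).map Prod.fst).Sublist l := by
  induction l generalizing m with
  | nil => simp
  | cons x l ih =>
    cases m with
    | nil => simp
    | cons y m => simpa using ih m

theorem colourClass_sublist (W w : List ℕ) (c : ℕ) : (colourClass W w c).Sublist W :=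
  (List.filter_sublist.map _).trans (map_fst_zip_sublist W w)

theorem colourClass_map (W : List ℕ) (f : ℕ → ℕ) (c : ℕ) :
    colourClass W (W.map f) c = W.filter fun v => decide (f v = c) := by
  induction W with
  | nil => rfl
  | cons x W ih =>
    simp only [colourClass, List.map_cons, List.zip_cons_cons, List.filter_cons] at ih ⊢
    split <;> simp [ih]

/-! ### Separating a set of vertices -/

/-- The tasks to decompose `X` and `Y` may replace the one to decompose `U`. -/
structure IsGoodSplit (G : SimpleGraph (Fin n)) (b : ℕ) (U S X Y : List ℕ) : Prop where
  separator : IsSeparatorIn G (vset n U) (vset n X) (vset n Y) (vset n S)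
  left : IsVertexList n X
  right : IsVertexList n Y
  sep : IsVertexList n S
  boundary_left : (vertexBoundary G (vset n X)).card ≤ b
  boundary_right : (vertexBoundary G (vset n Y)).card ≤ b
  card_sep : (vset n S).card ≤ b
  left_lt : X.length < U.length
  right_lt : Y.length < U.length
  add_le : X.length + Y.length ≤ U.length

/-- Removing one vertex enlarges the boundary by at most that vertex, so strict inequality in `hb`
leaves room for it. -/
theorem isGoodSplit_single {b u : ℕ} (hU : IsVertexList n (u :: U))
    (hb : (vertexBoundary G (vset n (u :: U))).card < b) : IsGoodSplit G b (u :: U) [u] U [] where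
  separator := by
    have hu : ∀ i : Fin n, i ∈ vset n U → i ∉ vset n [u] := by
      intro i hi h
      rw [mem_vset] at hi h
      rw [List.mem_singleton] at h
      exact (List.nodup_cons.1 hU.1).1 (h ▸ hi)
    refine isSeparatorIn_of_not_adj (fun v => ?_) ?_ ?_ ?_ fun x _ y hy => ?_
    · simp only [mem_vset, List.mem_cons, List.not_mem_nil, or_false, false_or]
      exact or_comm
    · exact Finset.disjoint_left.2 fun i _ => by simp [mem_vset]
    · exact Finset.disjoint_left.2 hu
    · exact Finset.disjoint_left.2 fun i => by simp [mem_vset]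
    · simp [mem_vset] at hy
  left := hU.sublist (List.sublist_cons_self _ _)
  right := isVertexList_nil
  sep := hU.sublist (by simp)
  boundary_left := by
    have hsub : vertexBoundary G (vset n U) ⊆
        vertexBoundary G (vset n (u :: U)) ∪ vset n [u] := by
      intro v hv
      obtain ⟨h1, x, hx, hvx⟩ := mem_vertexBoundary.1 hv
      rw [Finset.mem_union, mem_vertexBoundary]
      simp only [mem_vset, List.mem_cons, List.not_mem_nil, or_false] at h1 hx ⊢
      by_cases hvu : v.val = u
      · exact .inr hvu
      · exact .inl ⟨not_or.2 ⟨hvu, h1⟩, x, by simp [hx], hvx⟩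
    have h1 := (Finset.card_le_card hsub).trans (Finset.card_union_le _ _)
    rw [(hU.sublist (X := [u]) (by simp)).card_vset, List.length_singleton] at h1
    omega
  boundary_right := by
    have : vertexBoundary G (vset n []) = ∅ := by
      ext v
      simp [mem_vertexBoundary, mem_vset]
    simp [this]
  card_sep := by
    rw [(hU.sublist (X := [u]) (by simp)).card_vset, List.length_singleton]
    omega
  left_lt := by simp
  right_lt := by simp
  add_le := by simp

/-- `X` contains no neighbour of `B`, so its boundary lies in `(W \ B) ∪ S`, which is no larger than
`W` because `|S| ≤ |B|`. The same holds for `Y` with `A` in place of `B`. -/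
theorem isGoodSplit_of_mem (hE : IsEdgeList G E) (hU : IsVertexList n U) {b : ℕ} {w : List ℕ}
    (hW : (boundaryList (List.range n) E U).length ≤ b)
    (h : (S, X) ∈ trySplit E U (boundaryList (List.range n) E U) w) :
    IsGoodSplit G b U S X (U.filter fun v => decide (v ∉ S ∧ v ∉ X)) := by
  set W := boundaryList (List.range n) E U with hWdef
  have hWV : IsVertexList n W := isVertexList_boundaryList
  have hWU : ∀ x ∈ W, x ∉ U := by
    intro x hx
    have := (List.mem_filter.1 hx).2
    simp only [decide_eq_true_eq] at this
    exact this.1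
  have hbd : vset n W = vertexBoundary G (vset n U) := vset_boundaryList hE
  set A := colourClass W w 0 with hA
  set B := colourClass W w 1 with hB
  have hAW : A.Sublist W := colourClass_sublist W w 0
  have hBW : B.Sublist W := colourClass_sublist W w 1
  rw [trySplit] at h
  split_ifs at h with hc
  swap
  · simp at h
  rw [List.mem_singleton, Prod.mk.injEq] at h
  obtain ⟨hA0, hB0, hSA, hSB⟩ := hc
  rw [← h.1] at hSA hSB
  have hsep := separatesLists_minCut E U (neighbours E U A) (neighbours E U B)
    (List.filter_subset_self _) (List.filter_subset_self _)
  rw [← h.1, ← h.2] at hsep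
  have hSU : S.Sublist U := h.1 ▸ List.filter_sublist
  have hXU : X.Sublist U := h.2 ▸ List.filter_sublist
  have hXS : ∀ x ∈ X, x ∉ S := by
    intro x hx
    rw [h.2, cutSide, List.mem_filter, decide_eq_true_eq, ← h.1] at hx
    exact hx.2.1
  set Y := U.filter fun v => decide (v ∉ S ∧ v ∉ X) with hY
  have hYm : ∀ x, x ∈ Y ↔ x ∈ U ∧ x ∉ S ∧ x ∉ X := by
    intro x
    simp [hY]
  have hX := hU.sublist hXU
  have hS := hU.sublist hSU
  have hYV : IsVertexList n Y := hU.filter _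
  have hcard : ∀ C : List ℕ, C.Sublist W → S.length ≤ C.length →
      ((vset n W \ vset n C) ∪ vset n S).card ≤ b := by
    intro C hC hSC
    have hCW : vset n C ⊆ vset n W := fun i hi => mem_vset.2 (hC.subset (mem_vset.1 hi))
    have h1 := Finset.card_sdiff_add_card_eq_card hCW
    have h2 := Finset.card_union_le (vset n W \ vset n C) (vset n S)
    rw [(hWV.sublist hC).card_vset, hWV.card_vset] at h1
    rw [hS.card_vset] at h2
    omega
  have hbX : vertexBoundary G (vset n X) ⊆ (vset n W \ vset n B) ∪ vset n S := by
    intro u hu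
    obtain ⟨h1, x, hx, hux⟩ := mem_vertexBoundary.1 hu
    rw [mem_vset] at h1 hx
    rw [Finset.mem_union, Finset.mem_sdiff, mem_vset, mem_vset, mem_vset]
    by_cases huU : u.val ∈ U
    · exact .inr ((hsep.step x (hXU.subset hx) u huU (hE.mem_iff.2 hux.symm) hx).resolve_left h1)
    · refine .inl ⟨?_, fun huB => ?_⟩
      · rw [← mem_vset, hbd, mem_vertexBoundary]
        exact ⟨mem_vset.not.2 huU, x, mem_vset.2 (hXU.subset hx), hux⟩
      · exact hsep.right x (mem_neighbours.2 ⟨hXU.subset hx, u, huB, hE.mem_iff.2 hux⟩) hx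
  have hbY : vertexBoundary G (vset n Y) ⊆ (vset n W \ vset n A) ∪ vset n S := by
    intro u hu
    obtain ⟨h1, y, hy, huy⟩ := mem_vertexBoundary.1 hu
    rw [mem_vset, hYm] at h1 hy
    rw [Finset.mem_union, Finset.mem_sdiff, mem_vset, mem_vset, mem_vset]
    by_cases huU : u.val ∈ U
    · right
      by_contra huS
      have huX : u.val ∈ X := by
        by_contra huX
        exact h1 ⟨huU, huS, huX⟩
      exact (hsep.step u huU y hy.1 (hE.mem_iff.2 huy) huX).elim hy.2.2 hy.2.1
    · refine .inl ⟨?_, fun huA => ?_⟩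
      · rw [← mem_vset, hbd, mem_vertexBoundary]
        exact ⟨mem_vset.not.2 huU, y, mem_vset.2 hy.1, huy⟩
      · exact (hsep.left y (mem_neighbours.2 ⟨hy.1, u, huA, hE.mem_iff.2 huy⟩)).elim hy.2.2 hy.2.1
  -- If a side were all of `U`, its boundary would be `W` and contain `C`, which the inclusion
  -- excludes. This is where `A` and `B` must be nonempty.
  have hlt : ∀ Z C : List ℕ, Z.Sublist U → C ≠ [] → C.Sublist W →
      vertexBoundary G (vset n Z) ⊆ (vset n W \ vset n C) ∪ vset n S → Z.length < U.length := by
    intro Z C hZ hC0 hCW hsub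
    refine lt_of_le_of_ne hZ.length_le fun heq => ?_
    obtain rfl := hZ.eq_of_length heq
    obtain ⟨c, hc⟩ := List.exists_mem_of_ne_nil C hC0
    have hcW := hCW.subset hc
    have hcm : (⟨c, hWV.2 c hcW⟩ : Fin n) ∈ vset n W := mem_vset.2 hcW
    rw [hbd] at hcm
    have := hsub hcm
    rw [Finset.mem_union, Finset.mem_sdiff, mem_vset, mem_vset, mem_vset] at this
    rcases this with h' | h'
    · exact h'.2 hc
    · exact hWU c hcW (hSU.subset h')
  refine ⟨isSeparatorIn_of_not_adj (fun v => ?_) ?_ ?_ ?_ fun u hu v hv huv => ?_, hX, hYV, hS,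
    (Finset.card_le_card hbX).trans (hcard B hBW hSB),
    (Finset.card_le_card hbY).trans (hcard A hAW hSA), ?_, hlt X B hXU hB0 hBW hbX,
    hlt Y A List.filter_sublist hA0 hAW hbY, ?_⟩
  · rw [mem_vset, mem_vset, mem_vset, mem_vset, hYm]
    have h1 := @hXU.subset _ _ _ v.val
    have h2 := @hSU.subset _ _ _ v.val
    tauto
  · refine Finset.disjoint_left.2 fun i hi hi' => ?_
    rw [mem_vset] at hi hi'
    exact ((hYm _).1 hi').2.2 hi
  · refine Finset.disjoint_left.2 fun i hi hi' => ?_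
    rw [mem_vset] at hi hi'
    exact hXS _ hi hi'
  · refine Finset.disjoint_left.2 fun i hi hi' => ?_
    rw [mem_vset] at hi hi'
    exact ((hYm _).1 hi).2.1 hi'
  · rw [mem_vset] at hu hv
    rw [hYm] at hv
    exact (hsep.step u (hXU.subset hu) v hv.1 (hE.mem_iff.2 huv) hu).elim hv.2.2 hv.2.1
  · rw [hS.card_vset]
    exact hSA.trans (hAW.length_le.trans hW)
  · rw [← List.length_append]
    refine (List.Nodup.subperm ?_ ?_).length_le
    · exact List.nodup_append.2 ⟨hX.1, hYV.1, fun a ha c hc hac => ((hYm c).1 hc).2.2 (hac ▸ ha)⟩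
    · exact List.append_subset.2 ⟨hXU.subset, List.filter_subset_self _ ⟩

/-- All words of length `k` over `{0, 1, 2}`. -/
def words : ℕ → List (List ℕ)
  | 0 => [[]]
  | k + 1 => extendWords (words k)

theorem mem_words (w : List ℕ) (h : ∀ x ∈ w, x < 3) : w ∈ words w.length := by
  induction w with
  | nil => simp [words]
  | cons x w ih =>
    rw [List.length_cons, words, extendWords, List.mem_flatMap]
    refine ⟨w, ih fun y hy => h y (by simp [hy]), ?_⟩
    have : x < 3 := h x (by simp)
    interval_cases x <;> simp

theorem sz_words_le (k : ℕ) : sz (words k) ≤ 3 ^ k * (6 * k + 2) + 1 := by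
  have h : (words k).length = 3 ^ k ∧ ∀ w ∈ words k, sz w ≤ 6 * k + 1 := by
    induction k with
    | zero => simp [words, sz_nil]
    | succ k ih =>
      constructor
      · rw [words, extendWords, List.length_flatMap]
        simp [ih.1, pow_succ]
      · intro w hw
        rw [words, extendWords, List.mem_flatMap] at hw
        obtain ⟨v, hv, hw⟩ := hw
        have := ih.2 v hv
        simp only [List.mem_cons, List.not_mem_nil, or_false] at hw
        rcases hw with rfl | rfl | rfl <;> rw [sz_cons, sz_nat] <;> omega
  exact (sz_le_of_forall h.2).trans (by rw [h.1])

/-- Colour `W` according to a balanced separator `(P, S)` of `W`. The part `S'` of `S` inside `U`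
separates the neighbourhoods of the two colour classes, so the minimum cut is no larger than `S'`.
-/
theorem exists_trySplit (hE : IsEdgeList G E) (hU : IsVertexList n U) (hU0 : U ≠ []) {b : ℕ}
    (hW : (boundaryList (List.range n) E U).length = 3 * b) (hb : treewidth G < b) :
    (words (3 * b)).flatMap (trySplit E U (boundaryList (List.range n) E U)) ≠ [] := by
  classical
  set W := boundaryList (List.range n) E U with hWdef
  have hWV : IsVertexList n W := isVertexList_boundaryList
  have hWU : ∀ x ∈ W, x ∉ U := by
    intro x hx
    have := (List.mem_filter.1 hx).2
    simp only [decide_eq_true_eq] at this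
    exact this.1
  have hb0 : 0 < b := by
    obtain ⟨u, hu⟩ := List.exists_mem_of_ne_nil U hU0
    have : Nonempty (Fin n) := ⟨⟨u, hU.2 u hu⟩⟩
    have := treewidth_nonneg G
    omega
  obtain ⟨P, S, hPS, hSb, hstep, hP, hR, hP0, hR0⟩ :=
    exists_balanced_separator hb hb0 (W := vset n W) (by rw [hWV.card_vset, hW])
  let f : ℕ → ℕ := fun x => if x ∈ P.map Fin.valEmbedding then 0
    else if x ∈ S.map Fin.valEmbedding then 2 else 1
  have hf : ∀ i : Fin n, (f i = 0 ↔ i ∈ P) ∧ (f i = 1 ↔ i ∉ P ∪ S) := by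
    intro i
    have hi : ∀ T : Finset (Fin n), i.val ∈ T.map Fin.valEmbedding ↔ i ∈ T := by
      intro T
      simp only [Finset.mem_map, Fin.valEmbedding_apply, Fin.val_inj, exists_eq_right]
    simp only [f, hi, Finset.mem_union]
    by_cases h1 : i ∈ P <;> by_cases h2 : i ∈ S <;> simp [h1, h2]
  set A := colourClass W (W.map f) 0 with hA
  set B := colourClass W (W.map f) 1 with hB
  rw [colourClass_map] at hA hB
  have hAV : IsVertexList n A := hWV.sublist (colourClass_sublist ..)
  have hBV : IsVertexList n B := hWV.sublist (colourClass_sublist ..)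
  have hAm : ∀ i : Fin n, i.val ∈ A ↔ i.val ∈ W ∧ i ∈ P := by
    intro i
    rw [hA, List.mem_filter, decide_eq_true_eq, (hf i).1]
  have hBm : ∀ i : Fin n, i.val ∈ B ↔ i.val ∈ W ∧ i ∉ P ∪ S := by
    intro i
    rw [hB, List.mem_filter, decide_eq_true_eq, (hf i).2]
  have hAP : vset n A = vset n W ∩ P := by
    ext i
    rw [mem_vset, hAm, Finset.mem_inter, mem_vset]
  have hBR : vset n B = vset n W \ (P ∪ S) := by
    ext i
    rw [mem_vset, hBm, Finset.mem_sdiff, mem_vset]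
  rw [← hAP] at hP hP0
  rw [← hBR] at hR hR0
  let S' := U.filter fun v => decide (v ∈ S.map Fin.valEmbedding)
  have hS'V : IsVertexList n S' := hU.filter _
  have hS'm : ∀ i : Fin n, i.val ∈ S' ↔ i.val ∈ U ∧ i ∈ S := by
    intro i
    simp only [S', List.mem_filter, decide_eq_true_eq, Finset.mem_map, Fin.valEmbedding_apply,
      Fin.val_inj, exists_eq_right]
  have hsep : SeparatesLists E U (neighbours E U A) (neighbours E U B) S'
      {v | ∃ i ∈ P, i.val = v} := by
    have key : ∀ u v : Fin n, G.Adj u v → u ∈ P → v.val ∈ U →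
        v.val ∈ {v : ℕ | ∃ i ∈ P, i.val = v} ∨ v.val ∈ S' := by
      intro u v huv hu hv
      rcases hstep u hu v huv with h | h
      · exact .inl ⟨v, h, rfl⟩
      · exact .inr ((hS'm v).2 ⟨hv, h⟩)
    refine ⟨fun v hv => ?_, fun v hv => ?_, fun u hu v hv huv hP => ?_⟩
    · obtain ⟨hvU, a, ha, hav⟩ := mem_neighbours.1 hv
      obtain ⟨ha', hv', hadj⟩ := (hE _ _).1 hav
      exact key _ _ hadj ((hAm ⟨a, ha'⟩).1 ha).2 hvU
    · obtain ⟨hvU, c, hc, hcv⟩ := mem_neighbours.1 hv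
      obtain ⟨hc', hv', hadj⟩ := (hE _ _).1 hcv
      rintro ⟨i, hi, rfl⟩
      have := (hBm ⟨c, hc'⟩).1 hc
      rcases hstep i hi _ hadj.symm with h | h
      · exact this.2 (Finset.mem_union_left _ h)
      · exact this.2 (Finset.mem_union_right _ h)
    · obtain ⟨hu', hv', hadj⟩ := (hE _ _).1 huv
      obtain ⟨i, hi, rfl⟩ := hP
      exact key i ⟨v, hv'⟩ hadj hi hv
  have hcut : (minCut E U (neighbours E U A) (neighbours E U B)).length ≤ S'.length :=
    minCut_length_le hU.1 (List.filter_subset_self _) hsep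
  -- With `htotal` and `|B| ≤ 2b` this gives `|A| ≥ b - |W ∩ S| ≥ |S'|`, and likewise for `B`. The
  -- vertices of `W` in `S` are lost to both classes, but `S'` is smaller by the same number.
  have hcount : S'.length + (vset n W ∩ S).card ≤ b := by
    rw [← hS'V.card_vset, ← Finset.card_union_of_disjoint]
    · refine (Finset.card_le_card fun i hi => ?_).trans hSb
      rw [Finset.mem_union, mem_vset, hS'm, Finset.mem_inter] at hi
      exact hi.elim And.right And.right
    · refine Finset.disjoint_left.2 fun i hi hi' => ?_
      rw [mem_vset, hS'm] at hi
      rw [Finset.mem_inter, mem_vset] at hi'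
      exact hWU _ hi'.1 hi.1
  have htotal : A.length + B.length + (vset n W ∩ S).card = 3 * b := by
    rw [← hW, ← hWV.card_vset, ← hAV.card_vset, ← hBV.card_vset, hBR, hAP]
    have h1 := Finset.card_inter_add_card_sdiff (vset n W) (P ∪ S)
    rw [Finset.inter_union_distrib_left, Finset.card_union_of_disjoint] at h1
    · omega
    · exact hPS.mono Finset.inter_subset_right Finset.inter_subset_right
  rw [hAV.card_vset] at hP
  rw [hBV.card_vset] at hR
  intro hnil
  rw [List.flatMap_eq_nil_iff] at hnil
  have h1 : W.map f ∈ words (3 * b) := by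
    have := mem_words (W.map f) fun x hx => by
      obtain ⟨y, -, rfl⟩ := List.mem_map.1 hx
      simp only [f]
      split_ifs <;> omega
    rwa [List.length_map, hW] at this
  have h2 := hnil _ h1
  rw [trySplit, if_pos] at h2
  · simp at h2
  have hne : ∀ C : List ℕ, (vset n C).Nonempty → C ≠ [] := by
    rintro C ⟨i, hi⟩ rfl
    simp [mem_vset] at hi
  exact ⟨hne A hP0, hne B hR0, hcut.trans (show S'.length ≤ A.length by omega),
    hcut.trans (show S'.length ≤ B.length by omega)⟩

end
end SepWidth

namespace SepWidth
open Enc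

/-! ### Correctness of the algorithm -/

section
variable {n : ℕ} {G : SimpleGraph (Fin n)} {E : List (ℕ × ℕ)}

/-- The tasks in `todo` turn decompositions of the sets in `st` into one of the whole graph. -/
def Pending (G : SimpleGraph (Fin n)) (b : ℕ) : List Task → List (Finset (Fin n)) → Prop
  | [], st => st = [Finset.univ]
  | (false, U, _) :: todo, st => IsVertexList n U ∧ (vertexBoundary G (vset n U)).card ≤ b ∧
      Pending G b todo (vset n U :: st)
  | (true, U, S) :: todo, st => ∃ x y st', st = y :: x :: st' ∧ IsVertexList n U ∧
      IsSeparatorIn G (vset n U) x y (vset n S) ∧ (vertexBoundary G (vset n U)).card ≤ b ∧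
      (vset n S).card ≤ b ∧ Pending G b todo (vset n U :: st')

theorem Pending.mono {b b' : ℕ} (hb : b ≤ b') {todo : List Task} {st : List (Finset (Fin n))}
    (h : Pending G b todo st) : Pending G b' todo st := by
  induction todo generalizing st with
  | nil => exact h
  | cons τ todo ih =>
    obtain ⟨c, U, S⟩ := τ
    cases c with
    | false => exact ⟨h.1, h.2.1.trans hb, ih h.2.2⟩
    | true =>
      obtain ⟨x, y, st', h1, h2, h3, h4, h5, h6⟩ := h
      exact ⟨x, y, st', h1, h2, h3, h4.trans hb, h5.trans hb, ih h6⟩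

/-- A bound on the number of steps that the algorithm needs for a task, not counting the steps
that increase the width. -/
def taskCost (τ : Task) : ℕ := if τ.1 = true ∨ τ.2.1 = [] then 1 else 6 * τ.2.1.length - 2

/-- A bound on the number of remaining steps if the final bound on the width is at most `3k`. -/
def stepBound (k : ℕ) (s : State) : ℕ := (s.2.2.1.map taskCost).sum + (3 * k - s.2.1.1)

/-- A bound on the growth of the stacks in one step. -/
def growth (n : ℕ) : ℕ := 6 * (n * (2 * n + 1) + 1) + 30

/-- The invariant of the algorithm. -/
def Inv (G : SimpleGraph (Fin n)) (E : List (ℕ × ℕ)) (C : ℕ) (s : State) : Prop :=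
  ∃ (b : ℕ) (todo : List Task) (ts : List (SepTree (Fin n))),
    s = ((List.range n, E), ((3 * b, words (3 * b)), (todo, ts.map Data.ofSepTree))) ∧
    b ≤ (treewidth G + 1).toNat ∧ (∀ t ∈ ts, t.Separates G ∧ t.width G ≤ 3 * b) ∧
    Pending G (3 * b) todo (ts.map SepTree.vertexSet) ∧
    sz todo + sz (ts.map Data.ofSepTree) + growth n * stepBound (treewidth G + 1).toNat s ≤ C

theorem ofFinset_vset (U : List ℕ) : Data.ofFinset (vset n U) = enc (bits (List.range n) U) := by
  simp only [Data.ofFinset, enc, bits]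
  congr 1
  refine List.ext_getElem (by simp) fun i h1 h2 => ?_
  simp [mem_vset]

theorem nodeData_eq (U S : List ℕ) (l r : SepTree (Fin n)) :
    nodeData (List.range n) U S (Data.ofSepTree l) (Data.ofSepTree r) =
      Data.ofSepTree (.node (vset n U) (vset n S) l r) := by
  rw [Data.ofSepTree, ofFinset_vset, ofFinset_vset, nodeData]

theorem sz_bits_le (U : List ℕ) : sz (bits (List.range n) U) ≤ 4 * n + 1 := by
  refine (sz_le_of_forall (K := 3) fun b _ => sz_bool b).trans ?_
  rw [bits, List.length_map, List.length_range]
  omega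

theorem growth_bounds (n : ℕ) : 8 * n + 30 ≤ growth n := by
  unfold growth
  rcases Nat.eq_zero_or_pos n with rfl | h
  · norm_num
  · have := Nat.mul_le_mul_left n (show 2 ≤ 2 * n + 1 by omega)
    omega

theorem vset_eq_empty : vset n [] = ∅ := by
  ext
  simp [mem_vset]

/-- Common to both ways of splitting: a good split preserves the invariant and lowers the step
bound. -/
theorem inv_split {C b : ℕ} {U S X Y aux : List ℕ} {todo : List Task}
    {ts : List (SepTree (Fin n))} (hU0 : U ≠ [])
    (h : Inv G E C ((List.range n, E), ((3 * b, words (3 * b)),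
      ((false, U, aux) :: todo, ts.map Data.ofSepTree))))
    (hg : IsGoodSplit G (3 * b) U S X Y) {s' : State}
    (hs' : s' = ((List.range n, E), ((3 * b, words (3 * b)),
      (splitTasks U S X Y todo, ts.map Data.ofSepTree)))) :
    Inv G E C s' ∧ stepBound (treewidth G + 1).toNat s' <
      stepBound (treewidth G + 1).toNat ((List.range n, E), ((3 * b, words (3 * b)),
        ((false, U, aux) :: todo, ts.map Data.ofSepTree))) := by
  obtain ⟨b', todo', ts', heq, hb, hts, hp, hC⟩ := h
  simp only [Prod.mk.injEq, true_and] at heq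
  obtain ⟨⟨hbb, -⟩, rfl, hts'⟩ := heq
  obtain rfl : b = b' := by omega
  have hlen : ∀ Z : List ℕ, taskCost (false, Z, []) = if Z.length = 0 then 1
      else 6 * Z.length - 2 := by
    intro Z
    simp [taskCost, List.length_eq_zero_iff]
  -- The cost `6 * |U| - 2` is tight twice: when two nonempty sides exhaust `U`, and when `|U| = 1`
  -- and both sides are empty. One unit pays for the combination task and one for the present step.
  have hcost : taskCost (false, X, []) + taskCost (false, Y, []) + 1 + 1 ≤
      taskCost (false, U, aux) := by
    have hU : taskCost (false, U, aux) = 6 * U.length - 2 := by simp [taskCost, hU0]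
    have := hg.left_lt
    have := hg.right_lt
    have := hg.add_le
    rw [hlen, hlen, hU]
    split_ifs <;> omega
  have hstep : stepBound (treewidth G + 1).toNat s' + 1 ≤
      stepBound (treewidth G + 1).toNat ((List.range n, E), ((3 * b, words (3 * b)),
        ((false, U, aux) :: todo, ts.map Data.ofSepTree))) := by
    subst hs'
    simp only [stepBound, splitTasks, List.map_cons, List.sum_cons]
    have : taskCost (true, U, S) = 1 := by simp [taskCost]
    omega
  refine ⟨⟨b, _, ts', hts' ▸ hs', hb, hts, ?_, ?_⟩, by omega⟩
  · obtain ⟨h1, h2, h3⟩ := hp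
    exact ⟨hg.left, hg.boundary_left, hg.right, hg.boundary_right, _, _, _, rfl, h1, hg.separator,
      h2, hg.card_sep, h3⟩
  -- The drop of the step bound releases `growth n`, which pays for the vertex lists pushed onto the
  -- stack.
  · have h1 := hg.left.sz_le
    have h2 := hg.right.sz_le
    have h3 := hg.sep.sz_le
    have h4 := hp.1.sz_le
    have h5 := Nat.mul_le_mul_left (growth n) hstep
    rw [Nat.mul_succ] at h5
    have h6 := sz_bool true
    have h7 := sz_bool false
    have h8 := one_le_sz (false, U, aux)
    have h9 : growth n = 6 * (n * (2 * n + 1) + 1) + 30 := rfl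
    simp only [splitTasks, sz_cons, sz_pair, sz_nil] at hC ⊢
    omega

/-- The stack sizes plus `growth n` times the remaining number of steps act as a potential that
never increases. Raising the width bound is paid from the term `3 * k - s.2.1.1` of `stepBound`. -/
theorem inv_step {C : ℕ} (hE : IsEdgeList G E) {s : State} (h : Inv G E C s)
    (hgo : ¬ s.2.2.1 = []) : Inv G E C (step s) ∧
      stepBound (treewidth G + 1).toNat (step s) < stepBound (treewidth G + 1).toNat s := by
  have hInv := h
  obtain ⟨b, todo, ts, rfl, hb, hts, hp, hC⟩ := h
  have hg9 := growth_bounds n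
  cases todo with
  | nil => exact absurd rfl hgo
  | cons τ todo =>
  obtain ⟨c, U, S⟩ := τ
  cases c with
  | true =>
    obtain ⟨x, y, st', h1, hU, h3, h4, h5, h6⟩ := hp
    obtain ⟨r, ts, rfl, rfl, h2⟩ := List.map_eq_cons_iff.1 h1
    obtain ⟨l, ts, rfl, rfl, rfl⟩ := List.map_eq_cons_iff.1 h2
    have hs : step ((List.range n, E), ((3 * b, words (3 * b)), ((true, U, S) :: todo,
        (r :: l :: ts).map Data.ofSepTree))) =
        ((List.range n, E), ((3 * b, words (3 * b)), (todo,
          (SepTree.node (vset n U) (vset n S) l r :: ts).map Data.ofSepTree))) := by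
      simp [step, nodeData_eq]
    have hcost : stepBound (treewidth G + 1).toNat ((List.range n, E), ((3 * b, words (3 * b)),
        (todo, (SepTree.node (vset n U) (vset n S) l r :: ts).map Data.ofSepTree))) + 1 =
        stepBound (treewidth G + 1).toNat ((List.range n, E), ((3 * b, words (3 * b)),
          ((true, U, S) :: todo, (r :: l :: ts).map Data.ofSepTree))) := by
      simp only [stepBound, List.map_cons, List.sum_cons]
      have : taskCost (true, U, S) = 1 := by simp [taskCost]
      omega
    rw [hs]
    refine ⟨⟨b, todo, _, rfl, hb, ?_, h6, ?_⟩, by omega⟩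
    · intro t ht
      rcases List.mem_cons.1 ht with rfl | ht
      · have hl := hts l (by simp)
        have hr := hts r (by simp)
        refine ⟨⟨h3, hl.1, hr.1⟩, ?_⟩
        simp only [SepTree.width, max_le_iff]
        exact ⟨⟨h4, h5⟩, hl.2, hr.2⟩
      · exact hts t (by simp [ht])
    · rw [← hcost, Nat.mul_succ] at hC
      have h7 := sz_bits_le (n := n) U
      have h8 := sz_bits_le (n := n) S
      have h9 : sz (Data.ofSepTree (.node (vset n U) (vset n S) l r)) =
          sz (bits (List.range n) U) + sz (bits (List.range n) S) + 1 +
            (sz (Data.ofSepTree l) + sz (Data.ofSepTree r) + 1) + 1 := by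
        rw [← nodeData_eq]
        rfl
      simp only [List.map_cons, sz_cons] at hC ⊢
      omega
  | false =>
    have hs : step ((List.range n, E), ((3 * b, words (3 * b)), ((false, U, S) :: todo,
        ts.map Data.ofSepTree))) = solveStep (List.range n) E (3 * b) (words (3 * b))
          ((false, U, S) :: todo) (ts.map Data.ofSepTree) U := by
      simp [step]
    rw [hs]
    have hU := hp.1
    have hbd : (vertexBoundary G (vset n U)).card = (boundaryList (List.range n) E U).length := by
      rw [← vset_boundaryList hE, isVertexList_boundaryList.card_vset]
    by_cases hU0 : U = []
    · subst hU0
      have hs' : solveStep (List.range n) E (3 * b) (words (3 * b)) ((false, [], S) :: todo)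
          (ts.map Data.ofSepTree) [] = ((List.range n, E), ((3 * b, words (3 * b)), (todo,
            (SepTree.leaf :: ts).map Data.ofSepTree))) := by
        simp [solveStep, Data.ofSepTree]
      have hcost : stepBound (treewidth G + 1).toNat ((List.range n, E), ((3 * b, words (3 * b)),
          (todo, (SepTree.leaf :: ts).map Data.ofSepTree))) + 1 =
          stepBound (treewidth G + 1).toNat ((List.range n, E), ((3 * b, words (3 * b)),
            ((false, [], S) :: todo, ts.map Data.ofSepTree))) := by
        simp only [stepBound, List.map_cons, List.sum_cons]
        have : taskCost (false, [], S) = 1 := by simp [taskCost]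
        omega
      rw [hs']
      refine ⟨⟨b, todo, _, rfl, hb, ?_, ?_, ?_⟩, by omega⟩
      · intro t ht
        rcases List.mem_cons.1 ht with rfl | ht
        · exact ⟨trivial, Nat.zero_le _⟩
        · exact hts t ht
      · have := hp.2.2
        rwa [vset_eq_empty] at this
      · rw [← hcost, Nat.mul_succ] at hC
        have h9 : sz (Data.ofSepTree (n := n) .leaf) = 1 := rfl
        simp only [List.map_cons, sz_cons] at hC ⊢
        omega
    by_cases hW : (boundaryList (List.range n) E U).length < 3 * b
    · obtain ⟨u, U, rfl⟩ := List.exists_cons_of_ne_nil hU0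
      refine inv_split hU0 hInv (isGoodSplit_single hU (hbd ▸ hW)) ?_
      simp [solveStep, hW]
    have hWb : (boundaryList (List.range n) E U).length = 3 * b := by
      have := hp.2.1
      omega
    by_cases hT : (words (3 * b)).flatMap (trySplit E U (boundaryList (List.range n) E U)) = []
    -- Failure of every word certifies that the treewidth is at least `b`, so the raised bound stays
    -- within `tw + 1`.
    · have hb' : b + 1 ≤ (treewidth G + 1).toNat := by
        by_contra hlt
        refine exists_trySplit hE hU hU0 hWb ?_ hT
        omega
      have hs' : solveStep (List.range n) E (3 * b) (words (3 * b)) ((false, U, S) :: todo)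
          (ts.map Data.ofSepTree) U = ((List.range n, E), ((3 * (b + 1), words (3 * (b + 1))),
            ((false, U, S) :: todo, ts.map Data.ofSepTree))) := by
        simp only [solveStep, hU0, hW, hT, if_true, if_false]
        rfl
      have hcost : stepBound (treewidth G + 1).toNat ((List.range n, E), ((3 * (b + 1),
          words (3 * (b + 1))), ((false, U, S) :: todo, ts.map Data.ofSepTree))) <
          stepBound (treewidth G + 1).toNat ((List.range n, E), ((3 * b, words (3 * b)),
            ((false, U, S) :: todo, ts.map Data.ofSepTree))) := by
        simp only [stepBound]
        omega
      rw [hs']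
      refine ⟨⟨b + 1, _, ts, rfl, hb', fun t ht => ?_, hp.mono (by omega), ?_⟩, hcost⟩
      · exact ⟨(hts t ht).1, (hts t ht).2.trans (by omega)⟩
      · have := Nat.mul_le_mul_left (growth n) hcost.le
        omega
    · obtain ⟨⟨S', X⟩, rest, hSX⟩ := List.exists_cons_of_ne_nil hT
      have hmem : (S', X) ∈ (words (3 * b)).flatMap
          (trySplit E U (boundaryList (List.range n) E U)) := by simp [hSX]
      obtain ⟨w, -, hw⟩ := List.mem_flatMap.1 hmem
      refine inv_split hU0 hInv (isGoodSplit_of_mem hE hU hWb.le hw) ?_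
      simp only [solveStep, hU0, hW, hT, if_false]
      rw [hSX]
      rfl

/-! ### The running time -/

/-- Separates the exponential factor `z` of the state size from the part that is polynomial in `n`.
-/
theorem eval_mul_le (p : Polynomial ℕ) (a : ℕ) {z : ℕ} (hz : 1 ≤ z) :
    p.eval (a * z) ≤ p.eval a * z ^ p.natDegree := by
  rw [Polynomial.eval_eq_sum_range, Polynomial.eval_eq_sum_range, Finset.sum_mul]
  refine Finset.sum_le_sum fun i hi => ?_
  rw [mul_pow, ← mul_assoc]
  exact Nat.mul_le_mul_left _ (Nat.pow_le_pow_right hz (Finset.mem_range_succ_iff.1 hi))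

open Classical in
/-- The adjacency matrix of a graph. -/
noncomputable def adjMatrix (G : SimpleGraph (Fin n)) : List (List Bool) :=
  List.ofFn fun i => List.ofFn fun j => decide (G.Adj i j)

theorem ofGraph_eq (G : SimpleGraph (Fin n)) : Data.ofGraph G = enc (adjMatrix G) := by
  simp only [Data.ofGraph, enc, adjMatrix, List.map_ofFn, Function.comp_def]

theorem sz_adjMatrix_le (G : SimpleGraph (Fin n)) : sz (adjMatrix G) ≤ n * (n * 4 + 2) + 1 := by
  refine (sz_le_of_forall (K := n * 4 + 1) fun l hl => ?_).trans ?_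
  · obtain ⟨i, rfl⟩ := (List.mem_ofFn' _ _).1 hl
    refine (sz_le_of_forall (K := 3) fun b _ => sz_bool b).trans ?_
    simp
  · simp [adjMatrix]

theorem isEdgeList_adjMatrix (G : SimpleGraph (Fin n)) : IsEdgeList G (edgeList (adjMatrix G)) := by
  intro i j
  have hlen : (adjMatrix G).length = n := by simp [adjMatrix]
  simp only [edgeList, hlen, List.mem_flatMap, List.mem_range, List.mem_map, List.mem_filter,
    decide_eq_true_eq, Prod.mk.injEq]
  constructor
  · rintro ⟨i, hi, j, ⟨hj, h⟩, rfl, rfl⟩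
    refine ⟨hi, hj, ?_⟩
    simpa [adjMatrix, List.getD_eq_getElem?_getD, hi, hj] using h
  · rintro ⟨hi, hj, h⟩
    refine ⟨i, hi, j, ⟨hj, ?_⟩, rfl, rfl⟩
    simpa [adjMatrix, List.getD_eq_getElem?_getD, hi, hj] using h

theorem exists_program : ∃ (P : Program) (c : ℕ) (p : Polynomial ℕ),
    ∀ (n : ℕ) (G : SimpleGraph (Fin n)), ∃ (T : SepTree (Fin n)) (time : ℕ),
      P.Runs (Data.ofGraph G) (Data.ofSepTree T) time ∧ T.IsDecomposition G ∧
      (T.width G : ℤ) ≤ 3 * (treewidth G + 1) ∧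
      time ≤ 2 ^ (c * (treewidth G).toNat) * p.eval n := by
  obtain ⟨PI, pI, hI⟩ := PT.initialState
  obtain ⟨PL, pL, hL⟩ := exists_loop (go := fun s : State => ¬ s.2.2.1 = [])
    (PT.not (PT.eq_nil (.fst (.snd (.snd .id))))) PT.step
  obtain ⟨PF, pF, hF⟩ := PT.headD (.snd (.snd (.snd (PT.id (α := State))))) (PT.const Data.nil)
  let X : Polynomial ℕ := .X
  let x : Polynomial ℕ := X * (X * 4 + 2) + 1
  let D : Polynomial ℕ := 6 * (X * (2 * X + 1) + 1) + 30
  let a : Polynomial ℕ := 2 * pI.comp x + D * (6 * X + 4) + X + x + 40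
  let Q : Polynomial ℕ := pI + (9 * X + 3) * pL + pF + 2 * X
  let d := 7 * Q.natDegree
  -- The exponent involves `K ≤ (treewidth G).toNat + 1`; the factor `2 ^ d` absorbs the additional
  -- one.
  refine ⟨.comp PF (.comp PL PI), d, Q.comp a * 2 ^ d, fun n G => ?_⟩
  set K := (treewidth G + 1).toNat with hK
  set Z := 2 ^ (7 * K) with hZ
  have hx := sz_adjMatrix_le G
  have hxe : x.eval n = n * (n * 4 + 2) + 1 := by simp [x, X]
  have hDe : D.eval n = growth n := by simp [D, X, growth]
  have hae : a.eval n = 2 * pI.eval (x.eval n) + growth n * (6 * n + 4) + n + x.eval n + 40 := by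
    rw [← hDe]
    simp [a, X]
  have hZ1 : 1 ≤ Z := Nat.one_le_two_pow
  have hKZ : K < Z := (Nat.lt_two_pow_self (n := K)).trans_le
    (Nat.pow_le_pow_right (by norm_num) (by omega))
  obtain ⟨t₁, ht₁, hr₁⟩ := hI (adjMatrix G)
  have hlen : (adjMatrix G).length = n := by simp [adjMatrix]
  set E := edgeList (adjMatrix G) with hE
  have hinit : initialState (adjMatrix G) = ((List.range n, E),
      ((3 * 0, words (3 * 0)), ([(false, List.range n, [])], ([] : List (SepTree (Fin n))).map
        Data.ofSepTree))) := by
    rw [initialState, hlen]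
    rfl
  rw [hinit] at hr₁
  set s₀ : State := ((List.range n, E), ((3 * 0, words (3 * 0)),
      ([(false, List.range n, [])], ([] : List (SepTree (Fin n))).map Data.ofSepTree))) with hs₀
  have hS₀ : sz s₀ ≤ pI.eval (x.eval n) :=
    hr₁.size_le.trans (ht₁.trans (Polynomial.eval_mono_nat _ (hxe ▸ hx)))
  have hcost : stepBound K s₀ ≤ 6 * n + 1 + 3 * K := by
    simp only [stepBound, hs₀, List.map_cons, List.sum_cons, List.map_nil, List.sum_nil, taskCost,
      List.length_range]
    split_ifs <;> omega
  set C := sz s₀ + growth n * (6 * n + 1 + 3 * K) with hC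
  have hsize : ∀ s, Inv G E C s → sz s ≤ a.eval n * Z := by
    rintro _ ⟨b, todo, ts, rfl, hb, -, -, hCs⟩
    have h1 : sz (words (3 * b)) ≤ 20 * Z + 1 := by
      refine (sz_words_le _).trans (Nat.add_le_add_right ?_ 1)
      -- There are `27 ^ b ≤ 64 ^ K` words; the remaining factor `2 ^ K` of `Z` covers the length of
      -- a word.
      have e1 : 3 ^ (3 * b) ≤ 2 ^ (6 * K) := by
        rw [pow_mul, pow_mul]
        exact (Nat.pow_le_pow_left (by norm_num) b).trans (Nat.pow_le_pow_right (by norm_num) hb)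
      have e2 : 6 * (3 * b) + 2 ≤ 20 * 2 ^ K := by
        have := Nat.lt_two_pow_self (n := K)
        omega
      calc 3 ^ (3 * b) * (6 * (3 * b) + 2) ≤ 2 ^ (6 * K) * (20 * 2 ^ K) := Nat.mul_le_mul e1 e2
        _ = 20 * Z := by rw [hZ, mul_left_comm, ← pow_add]; congr 2; omega
    have h2 : growth n * (6 * n + 1 + 3 * K) ≤ growth n * (6 * n + 4) * Z := by
      rw [mul_assoc]
      refine Nat.mul_le_mul_left _ ?_
      nlinarith
    have h3 : sz (List.range n, E) ≤ sz s₀ := by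
      rw [hs₀, sz_pair (List.range n, E)]
      omega
    have h4 : sz s₀ ≤ pI.eval (x.eval n) * Z := hS₀.trans (Nat.le_mul_of_pos_right _ hZ1)
    have h5 : a.eval n * Z = 2 * (pI.eval (x.eval n) * Z) + growth n * (6 * n + 4) * Z + n * Z +
        x.eval n * Z + 40 * Z := by
      rw [hae]
      ring
    rw [sz_pair (List.range n, E), sz_pair (3 * b, words (3 * b)), sz_pair (3 * b), sz_nat,
      sz_pair todo]
    omega
  have hinv : Inv G E C s₀ := by
    refine ⟨0, _, [], rfl, by omega, by simp, ⟨isVertexList_range, ?_, ?_⟩, ?_⟩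
    · rw [Nat.mul_zero, Nat.le_zero, Finset.card_eq_zero]
      ext u
      simp [mem_vertexBoundary, mem_vset]
    · change [vset n (List.range n)] = [Finset.univ]
      congr 1
      ext u
      simp [mem_vset]
    · have h1 := Nat.mul_le_mul_left (growth n) hcost
      have h2 : sz ([(false, List.range n, [])] : List Task) +
          sz (([] : List (SepTree (Fin n))).map Data.ofSepTree) ≤ sz s₀ := by
        rw [hs₀, sz_pair (List.range n, E), sz_pair (3 * 0, words (3 * 0)),
          sz_pair [(false, List.range n, [])]]
        omega
      rw [← hK]
      omega
  obtain ⟨s₁, t₂, hr₂, hI₁, hgo, ht₂⟩ :=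
    hL (Inv G E C) (stepBound K) (a.eval n * Z) hsize
      (fun s hs hgo => inv_step (isEdgeList_adjMatrix G) hs hgo) s₀ hinv
  obtain ⟨t₃, ht₃, hr₃⟩ := hF s₁
  have hs₁ := hsize s₁ hI₁
  obtain ⟨b, todo, ts, rfl, hb, hts, hp, -⟩ := hI₁
  obtain rfl : todo = [] := not_not.1 hgo
  -- With no task left, `Pending` says that the stack holds exactly one decomposition, and that it
  -- is one of the whole vertex set.
  obtain ⟨T, ts', rfl, hT, hts'⟩ := List.map_eq_cons_iff.1 (show _ = _ from hp)
  obtain rfl : ts' = [] := by simpa using hts'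
  have hTs := hts T (by simp)
  have hrun := Program.Runs.comp (Program.Runs.comp hr₁ hr₂) hr₃
  rw [← ofGraph_eq] at hrun
  refine ⟨T, _, hrun, ⟨hT, hTs.1⟩, ?_, ?_⟩
  · have := hTs.2
    have := neg_one_le_treewidth G
    omega
  · have hQ : Q.eval (a.eval n * Z) ≤
        2 ^ (d * (treewidth G).toNat) * (Q.comp a * 2 ^ d).eval n := by
      refine (eval_mul_le Q _ hZ1).trans ?_
      have h1 : Z ^ Q.natDegree ≤ 2 ^ (d * (treewidth G).toNat) * 2 ^ d := by
        rw [hZ, ← pow_mul, ← pow_add]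
        refine Nat.pow_le_pow_right (by norm_num) ?_
        have h2 : K ≤ (treewidth G).toNat + 1 := by omega
        calc 7 * K * Q.natDegree ≤ 7 * ((treewidth G).toNat + 1) * Q.natDegree := by gcongr
          _ = d * (treewidth G).toNat + d := by ring
      refine (Nat.mul_le_mul_left _ h1).trans (le_of_eq ?_)
      simp only [Polynomial.eval_mul, Polynomial.eval_comp, Polynomial.eval_pow,
        Polynomial.eval_ofNat]
      ring
    have hM : sz (adjMatrix G) ≤ a.eval n * Z := by
      rw [← hxe] at hx
      refine (hx.trans ?_).trans (Nat.le_mul_of_pos_right _ hZ1)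
      rw [hae]
      omega
    have hnM : n ≤ a.eval n * Z := by
      refine le_trans ?_ (Nat.le_mul_of_pos_right _ hZ1)
      rw [hae]
      omega
    have hKM : K ≤ a.eval n * Z := by
      refine hKZ.le.trans (Nat.le_mul_of_pos_left _ ?_)
      rw [hae]
      omega
    generalize a.eval n * Z = M at hM hnM hKM hs₁ ht₂ hQ
    have h1 := ht₁.trans (Polynomial.eval_mono_nat pI hM)
    have h2 := ht₂.trans (Nat.mul_le_mul_right (pL.eval M)
      (show stepBound K s₀ + 1 ≤ 9 * M + 3 by omega))
    have h3 := ht₃.trans (Polynomial.eval_mono_nat pF hs₁)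
    have h4 : Q.eval M = pI.eval M + (9 * M + 3) * pL.eval M + pF.eval M + 2 * M := by
      simp [Q, X]
    refine le_trans ?_ hQ
    rw [h4, ofGraph_eq]
    simp only [sz] at hM
    omega

end
end SepWidth

/-! ### The main theorem. -/

theorem mainTheorem6 :
    (∀ (V : Type*) [Fintype V] (G : SimpleGraph V),
      (1 / 8 : ℝ) * (SepWidth.treewidth G : ℝ) + 1 / 24 ≤ (SepWidth.separatorWidth G : ℝ) ∧
      (SepWidth.separatorWidth G : ℝ) ≤ 3 * (SepWidth.treewidth G : ℝ) + 3) ∧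
    (∃ (P : SepWidth.Program) (c : ℕ) (p : Polynomial ℕ),
      ∀ (n : ℕ) (G : SimpleGraph (Fin n)),
        ∃ (T : SepWidth.SepTree (Fin n)) (time : ℕ),
          P.Runs (SepWidth.Data.ofGraph G) (SepWidth.Data.ofSepTree T) time ∧
          T.IsDecomposition G ∧
          (T.width G : ℤ) ≤ 3 * (SepWidth.treewidth G + 1) ∧
          time ≤ 2 ^ (c * (SepWidth.treewidth G).toNat) * p.eval n) := by
  refine ⟨fun V _ G => ?_, SepWidth.exists_program⟩
  have h1 : (SepWidth.treewidth G : ℝ) + 1 ≤ 2 * SepWidth.separatorWidth G := by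
    exact_mod_cast SepWidth.treewidth_add_one_le_separatorWidth G
  have h2 : (SepWidth.separatorWidth G : ℝ) ≤ SepWidth.treewidth G + 1 := by
    exact_mod_cast SepWidth.separatorWidth_le_treewidth G
  have h3 : (0 : ℝ) ≤ SepWidth.separatorWidth G := Nat.cast_nonneg _
  -- The stated constants are weaker than `h1` and `h2`; the second inequality also uses `tw + 1 ≥
  -- 0`, which follows from `h2` and `h3`.
  constructor <;> linarith
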